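/- **Lemma (Asymptotics for the three-line problem).** For $\gamma>2$ put $$g_\gamma(k)=\pi\left(2e^{-(2-\frac2\gamma)|k|}+e^{-\frac2\gamma|k|}-e^{-(4-\frac2\gamma)|k|}\right),\quad k\in\mathbb R,$$ $$\theta_\gamma(z)=\frac1{2\pi}\lim_{\epsilon\downarrow0}\int_{|k|\ge\epsilon}\frac{g_\gamma(k)\,(e^{izk}-izk)}{k(\cosh(2k)-1)}\,dk,\quad -1\le \operatorname{Im}z\le 0,$$ $$B_\gamma(z)=\frac{z-z_\gamma}{z-\overline{z_\gamma}},\quad z_\gamma=i\left(2-\tfrac2\gamma\right),\qquad h(z)=h^{(\gamma)}(z)=B_\gamma(z)\,e^{\theta_\gamma(z)},$$ and $h_y(x)=h(x+iy)$ for $x\in\mathbb R$, $-1\le y\le0$. Then for every $\gamma>2$ the limit defining $\theta_\gamma(z)$ exists (with absolutely convergent integrals over $|k|\ge\epsilon$), $h_0$ and $h_{-1}$ are the boundary values of $h$ on the strip $-1<\operatorname{Im}z<0$ (that is, $\int h_y\varphi\to\int h_0\varphi$ as $y\uparrow0$ and $\int h_y\varphi\to\int h_{-1}\varphi$ as $y\downarrow-1$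 for all Schwartz functions $\varphi$), and $h_{-2/\gamma},h_0\in L^\infty(\mathbb R)$, $h_{-1}\in L^2(\mathbb R)$. Moreover $$\lim_{\gamma\downarrow2}\frac{4\pi(\gamma-2)^{\gamma/2}}{\gamma^{\gamma/2}}\,\frac{\|h_{-2/\gamma}\|_{L^\infty(\mathbb R)}^\gamma}{\|h_0\|_{L^\infty(\mathbb R)}^{\gamma-2}\,\|h_{-1}\|_{L^2(\mathbb R)}^2}=1,$$ $$\lim_{\gamma\to\infty}4\pi\,\frac{\|h_{-2/\gamma}\|_{L^\infty(\mathbb R)}^\gamma}{\|h_0\|_{L^\infty(\mathbb R)}^{\gamma-2}\,\|h_{-1}\|_{L^2(\mathbb R)}^2}=V:=4\pi e^2\left(\int_{\mathbb R}\frac{x^2+9}{x^2+1}\,e^{2\operatorname{Re}\theta_\infty(x-i)}\,dx\right)^{-1},$$ where $$\operatorname{Re}\theta_\infty(x-i)=\int_0^\infty\frac{2e^{-2k}-e^{-4k}+1}{k(\cosh(2k)-1)}\bigl(\cos(xk)\sinh(k)-k\bigr)\,dk$$ and the last two integrals converge absolutely. Numerically $V\approx5.342823$, correct to six decimals: $|V-5.342823|<5\cdot10^{-7}$.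 -/

import Mathlib

open Filter Topology MeasureTheory
open scoped ENNReal SchwartzMap

noncomputable section

namespace ThreeLines

/-- The even weight `g_γ`. -/
def weight (γ k : ℝ) : ℝ :=
  Real.pi * (2 * Real.exp (-(2 - 2 / γ) * |k|) + Real.exp (-(2 / γ) * |k|)
    - Real.exp (-(4 - 2 / γ) * |k|))

/-- The integrand `g_γ(k) (e^{izk} - izk) / (k (cosh(2k) - 1))`. -/
def phaseIntegrand (γ : ℝ) (z : ℂ) (k : ℝ) : ℂ :=
  (weight γ k : ℂ) * (Complex.exp (Complex.I * z * k) - Complex.I * z * k) /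
    ((k * (Real.cosh (2 * k) - 1) : ℝ) : ℂ)

/-- `(2π)⁻¹` times the integral over `{k : |k| ≥ ε}`. -/
def truncatedPhase (γ : ℝ) (z : ℂ) (ε : ℝ) : ℂ :=
  (1 / (2 * Real.pi) : ℂ) * ∫ k in {k : ℝ | ε ≤ |k|}, phaseIntegrand γ z k

/-- The phase `θ_γ(z)`: the principal value, i.e. the limit of the truncations as `ε ↓ 0`. -/
def phase (γ : ℝ) (z : ℂ) : ℂ :=
  limUnder (𝓝[>] (0 : ℝ)) (truncatedPhase γ z)

/-- The zero `z_γ = i (2 - 2/γ)` of the Blaschke factor. -/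
def blaschkeZero (γ : ℝ) : ℂ := Complex.I * ((2 - 2 / γ : ℝ) : ℂ)

/-- The Blaschke factor `B_γ` of the upper half plane. -/
def blaschke (γ : ℝ) (z : ℂ) : ℂ :=
  (z - blaschkeZero γ) / (z - (starRingEnd ℂ) (blaschkeZero γ))

/-- The optimizer `h = B_γ e^{θ_γ}`. -/
def optimizer (γ : ℝ) (z : ℂ) : ℂ := blaschke γ z * Complex.exp (phase γ z)

/-- The restriction `h_y(x) = h(x + iy)` of `h` to a horizontal line. -/
def onLine (h : ℂ → ℂ) (y : ℝ) (x : ℝ) : ℂ := h ((x : ℂ) + Complex.I * (y : ℂ))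

/-- `f` is the boundary value, on the line `Im z = y₀`, of the function `h` on the lower strip
`-1 < Im z < 0`: the functions `h_y` converge to `f` as tempered distributions when `y → y₀`
from inside the strip. -/
def IsBoundaryValue (h : ℂ → ℂ) (y₀ : ℝ) (f : ℝ → ℂ) : Prop :=
  ∀ φ : 𝓢(ℝ, ℂ), Tendsto (fun y : ℝ => ∫ x, onLine h y x * φ x)
    (𝓝[Set.Ioo (-1 : ℝ) 0] y₀) (𝓝 (∫ x, f x * φ x))

/-- The `L^p(ℝ)` norm as a real number. -/
def lpNormReal (p : ℝ≥0∞) (f : ℝ → ℂ) : ℝ := (eLpNorm f p volume).toReal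

/-- The three lines ratio
`‖h_{-2/γ}‖_∞^γ / (‖h_0‖_∞^{γ-2} ‖h_{-1}‖_2^2)` of the function `h`. -/
def threeLinesRatio (γ : ℝ) (h : ℂ → ℂ) : ℝ :=
  lpNormReal ∞ (onLine h (-(2 / γ))) ^ γ /
    (lpNormReal ∞ (onLine h 0) ^ (γ - 2) * lpNormReal 2 (onLine h (-1)) ^ 2)

/-- The integrand in the formula for `Re θ_∞(x - i)`. -/
def rePhaseInftyIntegrand (x k : ℝ) : ℝ :=
  (2 * Real.exp (-2 * k) - Real.exp (-4 * k) + 1) / (k * (Real.cosh (2 * k) - 1)) *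
    (Real.cos (x * k) * Real.sinh k - k)

/-- `Re θ_∞(x - i)`. -/
def rePhaseInfty (x : ℝ) : ℝ := ∫ k in Set.Ioi (0 : ℝ), rePhaseInftyIntegrand x k

/-- The integrand `(x² + 9) / (x² + 1) e^{2 Re θ_∞(x - i)}`. -/
def limitIntegrand (x : ℝ) : ℝ :=
  (x ^ 2 + 9) / (x ^ 2 + 1) * Real.exp (2 * rePhaseInfty x)

/-- The limit value `4 π e² (∫ (x² + 9) / (x² + 1) e^{2 Re θ_∞(x - i)} dx)⁻¹`. -/
def limitValue : ℝ := 4 * Real.pi * Real.exp 2 * (∫ x : ℝ, limitIntegrand x)⁻¹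

end ThreeLines

end

noncomputable section

namespace ThreeLines

open Set

/-! ### Elementary bounds -/

/-! The weight is even and the denominator odd, so pairing `k` with `-k` leaves `sin (zk) - zk`,
whose cubic zero at `k = 0` cancels the singularity. With `t = 2 / γ` the phase becomes `i *
halfPhase t z`, an absolutely convergent integral with integrand `O(‖z‖ ^ 3 * exp (-k / 2))`. It is
jointly continuous in `(t, z)` up to `t = 0` and `t = 1`, the two limiting cases.

On `Im z = -s` with `0 ≤ s ≤ 1`, both the modulus of the Blaschke factor and `Re θ` are largest at
`x = 0`. Hence the sup norms are values at `x = 0`, with `‖h_0‖_∞ = 1`, and the ratio is `((1 - t)⁻¹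
* exp (Re θ(-it))) ^ γ / lineNormSq t` (`threeLinesRatio_eq`).

As `γ → ∞`, `(1 - t) ^ (-γ)` tends to `e²`, the phase contributes `γ * O(t ^ 3) → 0`, and
`lineNormSq t → lineNormSq 0` by dominated convergence. As `γ ↓ 2`, the pole of the Blaschke factor
reaches the line `Im z = -1`. The rescaling `x = (1 - t) u` gives `(1 - t) * lineNormSq t → 4π exp
(2 Re θ(-i))` with `θ` taken at `t = 1`. This exponential cancels the one in the numerator, and the
remaining power `(1 - t) ^ (1 - γ / 2)` tends to `1`. Domination rests on the decay estimate
`rePhase_le_sub_log`, a comparison with a Frullani integral.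

The numerical claim follows from a closed form. At `t = 0`, Frullani's integral, Euler's product for
`cosh` and Stirling's formula give the limit integrand as `(e⁴ / 4) sech² (πx / 2)`, so that `V =
4π² / e²`. -/

lemma norm_cos_le_cosh_im (w : ℂ) : ‖Complex.cos w‖ ≤ Real.cosh w.im := by
  rw [Complex.cos, Real.cosh_eq]
  rw [norm_div]
  have h := norm_add_le (Complex.exp (w * Complex.I)) (Complex.exp (-w * Complex.I))
  simp only [Complex.norm_exp] at h
  have e1 : (w * Complex.I).re = -w.im := by simp
  have e2 : (-w * Complex.I).re = w.im := by simp
  rw [e1, e2] at h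
  have : ‖(2 : ℂ)‖ = 2 := by simp
  rw [this]
  linarith

lemma convex_im_le (b : ℝ) : Convex ℝ {w : ℂ | |w.im| ≤ b} := by
  have : {w : ℂ | |w.im| ≤ b} = Complex.imCLM ⁻¹' (Icc (-b) b) := by
    ext w; simp [abs_le]
  rw [this]
  exact (convex_Icc _ _).linear_preimage Complex.imCLM.toLinearMap

lemma norm_sin_le {b : ℝ} {w : ℂ} (hw : |w.im| ≤ b) :
    ‖Complex.sin w‖ ≤ Real.cosh b * ‖w‖ := by
  have hb : 0 ≤ b := (abs_nonneg _).trans hw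
  have h := (convex_im_le b).norm_image_sub_le_of_norm_deriv_le (f := Complex.sin)
    (C := Real.cosh b) (x := 0) (y := w) (fun x _ => Complex.differentiable_sin x)
    (fun x hx => by
      rw [Complex.deriv_sin]
      refine (norm_cos_le_cosh_im x).trans ?_
      rw [Real.cosh_le_cosh, abs_of_nonneg hb]
      exact hx) (by simpa using hb) hw
  simpa using h

lemma norm_cos_sub_one_le {b : ℝ} {w : ℂ} (hw : |w.im| ≤ b) :
    ‖Complex.cos w - 1‖ ≤ Real.cosh b * ‖w‖ ^ 2 / 2 := by
  have h1 : Complex.cos w - 1 = -2 * Complex.sin (w / 2) ^ 2 := by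
    have := Complex.cos_sq' (w / 2)
    have h2 := Complex.cos_two_mul (w / 2)
    rw [show 2 * (w / 2) = w by ring] at h2
    rw [h2, this]; ring
  have h2 : ‖Complex.sin (w / 2)‖ ≤ Real.cosh (b / 2) * ‖w / 2‖ := by
    apply norm_sin_le
    have : (w / 2).im = w.im / 2 := by simp
    rw [this, abs_div, abs_of_pos (by norm_num : (0 : ℝ) < 2)]
    linarith
  have h3 : Real.cosh (b / 2) ^ 2 ≤ Real.cosh b := by
    have e := Real.cosh_two_mul (b / 2)
    rw [show 2 * (b / 2) = b by ring] at e
    nlinarith [sq_nonneg (Real.sinh (b / 2))]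
  rw [h1, norm_mul, norm_pow]
  have h4 : ‖w / 2‖ = ‖w‖ / 2 := by simp
  rw [h4] at h2
  have h5 : ‖(-2 : ℂ)‖ = 2 := by simp
  rw [h5]
  calc 2 * ‖Complex.sin (w / 2)‖ ^ 2 ≤ 2 * (Real.cosh (b / 2) * (‖w‖ / 2)) ^ 2 := by gcongr
    _ = Real.cosh (b / 2) ^ 2 * ‖w‖ ^ 2 / 2 := by ring
    _ ≤ _ := by gcongr

lemma norm_sin_sub_self_le {b : ℝ} {w : ℂ} (hw : |w.im| ≤ b) :
    ‖Complex.sin w - w‖ ≤ Real.cosh b * ‖w‖ ^ 3 / 2 := by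
  have hb : 0 ≤ b := (abs_nonneg _).trans hw
  have hconv : Convex ℝ ({w : ℂ | |w.im| ≤ b} ∩ Metric.closedBall 0 ‖w‖) :=
    (convex_im_le b).inter (convex_closedBall _ _)
  have h := hconv.norm_image_sub_le_of_norm_deriv_le (f := fun w => Complex.sin w - w)
    (C := Real.cosh b * ‖w‖ ^ 2 / 2) (x := 0) (y := w)
    (fun x _ => (Complex.differentiable_sin x).sub differentiableAt_id)
    (fun x hx => by
      have : deriv (fun w => Complex.sin w - w) x = Complex.cos x - 1 :=
        ((Complex.hasDerivAt_sin x).sub (hasDerivAt_id x)).deriv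
      rw [this]
      refine (norm_cos_sub_one_le hx.1).trans ?_
      have : ‖x‖ ≤ ‖w‖ := by simpa using hx.2
      have := Real.cosh_pos b
      gcongr) ⟨by simpa using hb, by simp⟩ ⟨hw, by simp⟩
  simp only [Complex.sin_zero, sub_zero] at h
  refine h.trans (le_of_eq ?_)
  ring

/-- A rate below `1` leaves room to absorb the linear factor `k`. The rate `3 / 4` is chosen for the
use below: its square times `cosh k ≤ exp k` still decays like `exp (-k / 2)`. -/
lemma le_exp_mul_sinh {k : ℝ} (hk : 0 ≤ k) : k ≤ 8 * Real.exp (-(3 / 4) * k) * Real.sinh k := by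
  have h1 : (1 + 2 * k) * Real.exp (-(2 * k)) ≤ 1 := by
    have := Real.add_one_le_exp (2 * k)
    rw [Real.exp_neg]
    rw [← div_eq_mul_inv, div_le_one (Real.exp_pos _)]
    linarith
  have h2 : 1 + 2 * k ≤ 8 * Real.exp (k / 4) := by
    have := Real.add_one_le_exp (k / 4)
    linarith
  have h3 : k * Real.exp k ≤ (1 + 2 * k) * Real.sinh k := by
    rw [Real.sinh_eq]
    have e : Real.exp (-k) = Real.exp k * Real.exp (-(2 * k)) := by
      rw [← Real.exp_add]; ring_nf
    rw [e]
    nlinarith [Real.exp_pos k]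
  have hs : 0 ≤ Real.sinh k := Real.sinh_nonneg_iff.2 hk
  have h4 : k * Real.exp k ≤ 8 * Real.exp (k / 4) * Real.sinh k :=
    h3.trans (by gcongr)
  have e2 : Real.exp (-(3 / 4) * k) = Real.exp (k / 4) * Real.exp (-k) := by
    rw [← Real.exp_add]; ring_nf
  rw [e2]
  calc k = k * Real.exp k * Real.exp (-k) := by
        rw [mul_assoc, ← Real.exp_add]; simp
    _ ≤ 8 * Real.exp (k / 4) * Real.sinh k * Real.exp (-k) := by gcongr
    _ = _ := by ring

lemma cosh_two_mul_sub_one (k : ℝ) : Real.cosh (2 * k) - 1 = 2 * Real.sinh k ^ 2 := by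
  have := Real.cosh_two_mul k
  have := Real.cosh_sq k
  linarith

lemma cosh_le_exp {k : ℝ} (hk : 0 ≤ k) : Real.cosh k ≤ Real.exp k := by
  rw [Real.cosh_eq]
  have : Real.exp (-k) ≤ Real.exp k := Real.exp_le_exp.2 (by linarith)
  linarith

lemma sq_mul_cosh_le {k : ℝ} (hk : 0 ≤ k) :
    k ^ 2 * Real.cosh k ≤ 64 * Real.exp (-(1 / 2) * k) * Real.sinh k ^ 2 := by
  have h := le_exp_mul_sinh hk
  calc k ^ 2 * Real.cosh k ≤ (8 * Real.exp (-(3 / 4) * k) * Real.sinh k) ^ 2 * Real.exp k := by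
        have := cosh_le_exp hk
        gcongr
    _ = 64 * (Real.exp (-(3 / 4) * k) * Real.exp (-(3 / 4) * k) * Real.exp k)
          * Real.sinh k ^ 2 := by ring
    _ = _ := by
        rw [← Real.exp_add, ← Real.exp_add]; ring_nf

/-! ### The symmetrised phase integral -/

/-- The weight `g_γ(k) / π` for `k > 0` as a function of `t = 2 / γ`. -/
def halfWeight (t k : ℝ) : ℝ :=
  2 * Real.exp (-(2 - t) * k) + Real.exp (-t * k) - Real.exp (-(4 - t) * k)

lemma weight_eq (γ k : ℝ) : weight γ k = Real.pi * halfWeight (2 / γ) |k| := rfl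

/-- One of the two copies of `exp (-(2 - t) k)` dominates the subtracted term; AM-GM applies to the
other copy and `exp (-t k)`. The bound gives positivity of the weight and, later, decay on `Im z =
-1`. -/
lemma two_mul_exp_neg_le_halfWeight {t k : ℝ} (hk : 0 ≤ k) :
    2 * Real.exp (-k) ≤ halfWeight t k := by
  unfold halfWeight
  have h1 : Real.exp (-(4 - t) * k) ≤ Real.exp (-(2 - t) * k) :=
    Real.exp_le_exp.2 (by nlinarith)
  have e1 : Real.exp (-(2 - t) * k) = Real.exp (-(1 - t / 2) * k) ^ 2 := by
    rw [← Real.exp_nat_mul]; push_cast; ring_nf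
  have e2 : Real.exp (-t * k) = Real.exp (-(t / 2) * k) ^ 2 := by
    rw [← Real.exp_nat_mul]; push_cast; ring_nf
  have e3 : Real.exp (-k) = Real.exp (-(1 - t / 2) * k) * Real.exp (-(t / 2) * k) := by
    rw [← Real.exp_add]; ring_nf
  nlinarith [sq_nonneg (Real.exp (-(1 - t / 2) * k) - Real.exp (-(t / 2) * k))]

lemma halfWeight_nonneg {t k : ℝ} (hk : 0 ≤ k) : 0 ≤ halfWeight t k :=
  (by positivity : (0 : ℝ) ≤ 2 * Real.exp (-k)).trans (two_mul_exp_neg_le_halfWeight hk)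

lemma halfWeight_le {t k : ℝ} (ht0 : 0 ≤ t) (ht1 : t ≤ 1) (hk : 0 ≤ k) : halfWeight t k ≤ 3 := by
  unfold halfWeight
  have h1 : Real.exp (-(2 - t) * k) ≤ 1 := Real.exp_le_one_iff.2 (by nlinarith)
  have h2 : Real.exp (-t * k) ≤ 1 := Real.exp_le_one_iff.2 (by nlinarith)
  have := Real.exp_pos (-(4 - t) * k)
  linarith

/-- The symmetrised integrand of the phase, up to the factor `i`. -/
def halfIntegrand (t : ℝ) (z : ℂ) (k : ℝ) : ℂ :=
  (halfWeight t k : ℂ) * (Complex.sin (z * k) - z * k) /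
    ((k * (Real.cosh (2 * k) - 1) : ℝ) : ℂ)

/-- The symmetrised phase integral; `θ_γ(z) = i halfPhase (2 / γ) z`. -/
def halfPhase (t : ℝ) (z : ℂ) : ℂ := ∫ k in Ioi (0 : ℝ), halfIntegrand t z k

/-- The real part of the phase. -/
def rePhase (t : ℝ) (z : ℂ) : ℝ := (Complex.I * halfPhase t z).re

lemma measurable_halfIntegrand (t : ℝ) (z : ℂ) : Measurable (halfIntegrand t z) := by
  unfold halfIntegrand halfWeight
  fun_prop

lemma norm_halfIntegrand_le {t : ℝ} {z : ℂ} {k : ℝ} (ht0 : 0 ≤ t) (ht1 : t ≤ 1)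
    (hz : |z.im| ≤ 1) (hk : 0 < k) :
    ‖halfIntegrand t z k‖ ≤ 48 * ‖z‖ ^ 3 * Real.exp (-(1 / 2) * k) := by
  have hs : 0 < Real.sinh k := Real.sinh_pos_iff.2 hk
  unfold halfIntegrand
  rw [norm_div, norm_mul, cosh_two_mul_sub_one, Complex.norm_real, Complex.norm_real,
    Real.norm_of_nonneg (halfWeight_nonneg hk.le),
    Real.norm_of_nonneg (by positivity : 0 ≤ k * (2 * Real.sinh k ^ 2)),
    div_le_iff₀ (by positivity)]
  have h1 : ‖Complex.sin (z * k) - z * k‖ ≤ Real.cosh k * ‖z * k‖ ^ 3 / 2 := by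
    apply norm_sin_sub_self_le
    simp only [Complex.mul_im, Complex.ofReal_re, Complex.ofReal_im, mul_zero, zero_add]
    rw [abs_mul, abs_of_pos hk]
    nlinarith
  rw [norm_mul, Complex.norm_real, Real.norm_of_nonneg hk.le] at h1
  have h2 := sq_mul_cosh_le hk.le
  -- The constant is `48 = 3 * (1 / 2) * 64 / 2`: the weight bound, the cubic sine bound,
  -- `sq_mul_cosh_le`, and the `2` in `cosh (2k) - 1 = 2 sinh² k`.
  calc halfWeight t k * ‖Complex.sin (z * k) - z * k‖
      ≤ 3 * (Real.cosh k * (‖z‖ * k) ^ 3 / 2) := by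
        have := halfWeight_le ht0 ht1 hk.le
        gcongr
    _ = 3 / 2 * ‖z‖ ^ 3 * k * (k ^ 2 * Real.cosh k) := by ring
    _ ≤ 3 / 2 * ‖z‖ ^ 3 * k * (64 * Real.exp (-(1 / 2) * k) * Real.sinh k ^ 2) := by gcongr
    _ = _ := by ring

lemma integrableOn_exp_neg_half (C : ℝ) :
    IntegrableOn (fun k : ℝ => C * Real.exp (-(1 / 2) * k)) (Ioi 0) :=
  (integrableOn_exp_mul_Ioi (by norm_num) 0).const_mul C

lemma integrableOn_halfIntegrand {t : ℝ} {z : ℂ} (ht0 : 0 ≤ t) (ht1 : t ≤ 1)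
    (hz : |z.im| ≤ 1) : IntegrableOn (halfIntegrand t z) (Ioi 0) := by
  refine Integrable.mono' (integrableOn_exp_neg_half (48 * ‖z‖ ^ 3))
    (measurable_halfIntegrand t z).aestronglyMeasurable ?_
  filter_upwards [ae_restrict_mem measurableSet_Ioi] with k hk
  exact norm_halfIntegrand_le ht0 ht1 hz hk

lemma norm_halfPhase_le {t : ℝ} {z : ℂ} (ht0 : 0 ≤ t) (ht1 : t ≤ 1) (hz : |z.im| ≤ 1) :
    ‖halfPhase t z‖ ≤ 96 * ‖z‖ ^ 3 := by
  have h := norm_integral_le_of_norm_le (integrableOn_exp_neg_half (48 * ‖z‖ ^ 3))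
    (f := halfIntegrand t z) (by
      filter_upwards [ae_restrict_mem measurableSet_Ioi] with k hk
      exact norm_halfIntegrand_le ht0 ht1 hz hk)
  refine h.trans (le_of_eq ?_)
  rw [integral_const_mul, integral_exp_mul_Ioi (by norm_num)]
  simp; ring

lemma abs_rePhase_le {t : ℝ} {z : ℂ} (ht0 : 0 ≤ t) (ht1 : t ≤ 1) (hz : |z.im| ≤ 1) :
    |rePhase t z| ≤ 96 * ‖z‖ ^ 3 := by
  refine (Complex.abs_re_le_norm _).trans ?_
  simpa using norm_halfPhase_le ht0 ht1 hz

/-- Continuity is joint, and the closed range of `t` includes both endpoints, because `t` and `z`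
move together in the limits `γ → ∞` and `γ ↓ 2`. -/
lemma continuousOn_halfPhase :
    ContinuousOn (fun p : ℝ × ℂ => halfPhase p.1 p.2) (Icc 0 1 ×ˢ {z | |z.im| ≤ 1}) := by
  intro p₀ hp₀
  refine continuousWithinAt_of_dominated
    (bound := fun k => 48 * (‖p₀.2‖ + 1) ^ 3 * Real.exp (-(1 / 2) * k)) ?_ ?_
    (integrableOn_exp_neg_half _) ?_
  · exact Eventually.of_forall fun p => (measurable_halfIntegrand _ _).aestronglyMeasurable
  · have hn : ∀ᶠ p : ℝ × ℂ in 𝓝[Icc 0 1 ×ˢ {z | |z.im| ≤ 1}] p₀, ‖p.2‖ < ‖p₀.2‖ + 1 := by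
      refine nhdsWithin_le_nhds ?_
      exact (continuous_snd.norm.tendsto p₀).eventually (gt_mem_nhds (by linarith))
    filter_upwards [hn, self_mem_nhdsWithin] with p hp hp'
    filter_upwards [ae_restrict_mem measurableSet_Ioi] with k hk
    refine (norm_halfIntegrand_le hp'.1.1 hp'.1.2 hp'.2 hk).trans ?_
    gcongr
  · refine Eventually.of_forall fun k => Continuous.continuousWithinAt ?_
    unfold halfIntegrand halfWeight
    fun_prop

lemma continuousOn_rePhase :
    ContinuousOn (fun p : ℝ × ℂ => rePhase p.1 p.2) (Icc 0 1 ×ˢ {z | |z.im| ≤ 1}) :=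
  Complex.continuous_re.comp_continuousOn (continuousOn_const.mul continuousOn_halfPhase)

/-- The real form of the integrand of `Re θ(x - i s)`. -/
lemma re_I_mul_halfIntegrand (t x s k : ℝ) :
    (Complex.I * halfIntegrand t (x - Complex.I * s) k).re =
      halfWeight t k * (Real.cos (x * k) * Real.sinh (s * k) - s * k) /
        (k * (Real.cosh (2 * k) - 1)) := by
  have e : Complex.I * halfIntegrand t (x - Complex.I * s) k =
      ((halfWeight t k / (k * (Real.cosh (2 * k) - 1)) : ℝ) : ℂ) *
        (Complex.I * (Complex.sin ((x - Complex.I * s) * k) - (x - Complex.I * s) * k)) := by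
    unfold halfIntegrand
    push_cast
    ring
  rw [e, Complex.re_ofReal_mul]
  have e2 : (x - Complex.I * s) * k = ((x * k : ℝ) : ℂ) + ((-(s * k) : ℝ) : ℂ) * Complex.I := by
    push_cast; ring
  rw [e2, Complex.sin_add_mul_I, ← Complex.ofReal_sin, ← Complex.ofReal_cos,
    ← Complex.ofReal_sinh, ← Complex.ofReal_cosh, Real.sinh_neg]
  simp only [Complex.mul_re, Complex.mul_im, Complex.I_re, Complex.I_im, Complex.sub_re,
    Complex.sub_im, Complex.add_re, Complex.add_im, Complex.ofReal_re, Complex.ofReal_im]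
  ring

lemma rePhase_eq_integral {t x s : ℝ} (ht0 : 0 ≤ t) (ht1 : t ≤ 1) (hs : |s| ≤ 1) :
    rePhase t (x - Complex.I * s) = ∫ k in Ioi (0 : ℝ),
      halfWeight t k * (Real.cos (x * k) * Real.sinh (s * k) - s * k) /
        (k * (Real.cosh (2 * k) - 1)) := by
  have hz : |(x - Complex.I * s : ℂ).im| ≤ 1 := by simpa using hs
  have h := (integrableOn_halfIntegrand ht0 ht1 hz).const_mul Complex.I
  unfold rePhase halfPhase
  rw [← integral_const_mul]
  have := integral_re h
  simp only [RCLike.re_eq_complex_re] at this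
  rw [← this]
  simp_rw [re_I_mul_halfIntegrand]

lemma integrableOn_rePhase_integrand {t x s : ℝ} (ht0 : 0 ≤ t) (ht1 : t ≤ 1) (hs : |s| ≤ 1) :
    IntegrableOn (fun k : ℝ => halfWeight t k * (Real.cos (x * k) * Real.sinh (s * k) - s * k) /
        (k * (Real.cosh (2 * k) - 1))) (Ioi 0) := by
  have hz : |(x - Complex.I * s : ℂ).im| ≤ 1 := by simpa using hs
  have h := ((integrableOn_halfIntegrand ht0 ht1 hz).const_mul Complex.I).re
  simp only [RCLike.re_eq_complex_re] at h
  simp only [re_I_mul_halfIntegrand] at h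
  exact h

/-- The weight and `sinh (s k)` are nonnegative, so for each `k` the integrand is largest when the
cosine equals `1`. -/
lemma rePhase_le_rePhase_zero {t x s : ℝ} (ht0 : 0 ≤ t) (ht1 : t ≤ 1) (hs0 : 0 ≤ s)
    (hs : s ≤ 1) : rePhase t (x - Complex.I * s) ≤ rePhase t ((0 : ℝ) - Complex.I * s) := by
  have hs' : |s| ≤ 1 := by rwa [abs_of_nonneg hs0]
  rw [rePhase_eq_integral ht0 ht1 hs', rePhase_eq_integral ht0 ht1 hs']
  refine setIntegral_mono_on (integrableOn_rePhase_integrand ht0 ht1 hs')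
    (integrableOn_rePhase_integrand ht0 ht1 hs') measurableSet_Ioi fun k hk => ?_
  have hk : 0 < k := hk
  have := halfWeight_nonneg (t := t) hk.le
  have h2 : 0 ≤ Real.sinh (s * k) := Real.sinh_nonneg_iff.2 (by positivity)
  have h3 := Real.cos_le_one (x * k)
  have h4 : Real.cos (x * k) * Real.sinh (s * k) ≤ Real.cos (0 * k) * Real.sinh (s * k) := by
    simp only [zero_mul, Real.cos_zero]; gcongr
  rw [cosh_two_mul_sub_one]
  gcongr

lemma rePhase_zero_le {t s : ℝ} (ht0 : 0 ≤ t) (ht1 : t ≤ 1) (hs0 : 0 ≤ s)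
    (hs : s ≤ 1) : rePhase t ((0 : ℝ) - Complex.I * s) ≤ 96 := by
  have hs' : |s| ≤ 1 := by rwa [abs_of_nonneg hs0]
  have h := abs_rePhase_le (z := (0 : ℝ) - Complex.I * s) ht0 ht1 (by simpa using hs')
  have h2 : ‖((0 : ℝ) - Complex.I * s : ℂ)‖ = s := by simp [abs_of_nonneg hs0]
  rw [h2] at h
  have : s ^ 3 ≤ 1 := pow_le_one₀ hs0 hs
  linarith [(abs_le.1 h).2]

lemma rePhaseInfty_eq (x : ℝ) : rePhaseInfty x = rePhase 0 (x - Complex.I * (1 : ℝ)) := by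
  rw [rePhase_eq_integral le_rfl zero_le_one (by simp)]
  unfold rePhaseInfty
  congr 1; ext k
  unfold rePhaseInftyIntegrand halfWeight
  simp only [sub_zero, neg_zero, zero_mul, Real.exp_zero, one_mul]
  ring

lemma integrableOn_rePhaseInftyIntegrand (x : ℝ) :
    IntegrableOn (rePhaseInftyIntegrand x) (Ioi 0) := by
  have := integrableOn_rePhase_integrand (t := 0) (x := x) (s := 1) le_rfl zero_le_one (by simp)
  convert this using 2 with k
  unfold rePhaseInftyIntegrand halfWeight
  simp only [sub_zero, neg_zero, zero_mul, Real.exp_zero, one_mul]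
  ring

/-! ### Frullani integrals -/

lemma norm_cexp_sub_cexp_le {u v : ℂ} {b : ℝ} (hu : u.re ≤ b) (hv : v.re ≤ b) :
    ‖Complex.exp u - Complex.exp v‖ ≤ Real.exp b * ‖u - v‖ := by
  refine (convex_halfSpace_re_le b).norm_image_sub_le_of_norm_deriv_le (f := Complex.exp)
    (fun x _ => Complex.differentiable_exp x) (fun x hx => ?_) hv hu
  rw [Complex.deriv_exp, Complex.norm_exp]
  exact Real.exp_le_exp.2 hx

/-- The integrand of the complex Frullani integral. -/
def frullaniIntegrand (c : ℝ) (a : ℂ) (k : ℝ) : ℂ :=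
  (Complex.exp (-(a * k)) - Complex.exp (-(c * k))) / k

lemma measurable_frullaniIntegrand (c : ℝ) (a : ℂ) : Measurable (frullaniIntegrand c a) := by
  unfold frullaniIntegrand
  fun_prop

lemma integrableOn_frullaniIntegrand {c : ℝ} {a : ℂ} (hc : 0 < c) (ha : 0 < a.re) :
    IntegrableOn (frullaniIntegrand c a) (Ioi 0) := by
  have hm : 0 < min a.re c := lt_min ha hc
  refine Integrable.mono' (((integrableOn_exp_mul_Ioi (neg_lt_zero.2 hm) 0)).const_mul ‖a - c‖)
    (measurable_frullaniIntegrand c a).aestronglyMeasurable ?_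
  filter_upwards [ae_restrict_mem measurableSet_Ioi] with k hk
  have hk : 0 < k := hk
  unfold frullaniIntegrand
  rw [norm_div, Complex.norm_real, Real.norm_of_nonneg hk.le, div_le_iff₀ hk]
  refine (norm_cexp_sub_cexp_le (b := -min a.re c * k) ?_ ?_).trans (le_of_eq ?_)
  · have := min_le_left a.re c
    simp only [Complex.neg_re, Complex.re_mul_ofReal]
    nlinarith
  · have := min_le_right a.re c
    simp only [Complex.neg_re, Complex.re_mul_ofReal, Complex.ofReal_re]
    nlinarith
  · rw [show -(a * k) - -((c : ℂ) * k) = -(a - c) * (k : ℂ) by ring, norm_mul, norm_neg,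
      Complex.norm_real, Real.norm_of_nonneg hk.le]
    ring

/-- Differentiating in `a` cancels the factor `1 / k` and leaves an exponential integral. Domination
is uniform on a ball where the real part stays above `a.re / 2`. -/
lemma hasDerivAt_frullani {c : ℝ} {a : ℂ} (hc : 0 < c) (ha : 0 < a.re) :
    HasDerivAt (fun a => ∫ k in Ioi (0 : ℝ), frullaniIntegrand c a k) (-a⁻¹) a := by
  have hre : ∀ x ∈ Metric.ball a (a.re / 2), a.re / 2 ≤ x.re := by
    intro x hx
    have h1 : |(x - a).re| ≤ ‖x - a‖ := Complex.abs_re_le_norm _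
    have h2 : ‖x - a‖ < a.re / 2 := by simpa [dist_eq_norm] using hx
    have := (abs_le.1 h1).1
    simp only [Complex.sub_re] at this
    linarith
  have h := hasDerivAt_integral_of_dominated_loc_of_deriv_le
    (μ := volume.restrict (Ioi (0 : ℝ)))
    (F := frullaniIntegrand c) (F' := fun a k => -Complex.exp (-(a * k))) (x₀ := a)
    (s := Metric.ball a (a.re / 2)) (bound := fun k => Real.exp (-(a.re / 2) * k))
    (Metric.ball_mem_nhds a (by linarith))
    (Eventually.of_forall fun x => (measurable_frullaniIntegrand c x).aestronglyMeasurable)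
    (integrableOn_frullaniIntegrand hc ha)
    (Measurable.aestronglyMeasurable (by fun_prop))
    (by
      filter_upwards [ae_restrict_mem measurableSet_Ioi] with k hk x hx
      have hk : 0 < k := hk
      rw [norm_neg, Complex.norm_exp, Real.exp_le_exp]
      have := hre x hx
      simp only [Complex.neg_re, Complex.re_mul_ofReal]
      nlinarith)
    (integrableOn_exp_mul_Ioi (by linarith) 0)
    (by
      filter_upwards [ae_restrict_mem measurableSet_Ioi] with k hk x _
      have hk : (k : ℂ) ≠ 0 := by exact_mod_cast (ne_of_gt hk : k ≠ 0)
      have h1 : HasDerivAt (fun x : ℂ => -(x * k)) (-(1 * (k : ℂ))) x :=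
        ((hasDerivAt_id x).mul_const (k : ℂ)).neg
      have h2 := (h1.cexp.sub_const (Complex.exp (-(c * k)))).div_const (k : ℂ)
      have e : Complex.exp (-(x * k)) * -(1 * (k : ℂ)) / k = -Complex.exp (-(x * k)) := by
        field_simp
      rw [e] at h2
      exact h2)
  have h2 := h.2
  have e : ∫ k in Ioi (0 : ℝ), -Complex.exp (-(a * k)) = -a⁻¹ := by
    have := integral_exp_mul_complex_Ioi (a := -a) (by simpa using ha) 0
    rw [integral_neg]
    simp only [neg_mul] at this
    rw [this]
    simp
  rwa [e] at h2

/-- **Frullani's integral** for complex exponentials. -/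
lemma integral_frullaniIntegrand {c : ℝ} {a : ℂ} (hc : 0 < c) (ha : 0 < a.re) :
    ∫ k in Ioi (0 : ℝ), frullaniIntegrand c a k = Real.log c - Complex.log a := by
  have hopen : IsOpen {a : ℂ | 0 < a.re} := isOpen_lt continuous_const Complex.continuous_re
  have hconv : Convex ℝ {a : ℂ | 0 < a.re} := convex_halfSpace_re_gt 0
  -- The integral plus `log a` has zero derivative on the connected right half plane, hence is
  -- constant; at `a = c` the integral vanishes.
  have hd : ∀ a ∈ {a : ℂ | 0 < a.re}, HasDerivAt
      (fun a => (∫ k in Ioi (0 : ℝ), frullaniIntegrand c a k) + Complex.log a) 0 a := by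
    intro a ha
    have := (hasDerivAt_frullani hc ha).add (Complex.hasDerivAt_log (Or.inl ha))
    rw [neg_add_cancel] at this
    exact this
  have h := hopen.is_const_of_deriv_eq_zero hconv.isPreconnected
    (fun a ha => (hd a ha).differentiableAt.differentiableWithinAt)
    (fun a ha => (hd a ha).deriv) (show a ∈ {a : ℂ | 0 < a.re} from ha)
    (show (c : ℂ) ∈ {a : ℂ | 0 < a.re} by simpa using hc)
  have h0 : ∫ k in Ioi (0 : ℝ), frullaniIntegrand c c k = 0 := by
    simp [frullaniIntegrand]
  simp only [h0, zero_add] at h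
  rw [Complex.ofReal_log hc.le, ← h]
  ring

lemma frullani_sinh_integrand (m k : ℝ) (hk : k ≠ 0) :
    Real.exp (-m * k) * (Real.sinh k / k - 1) =
      (1 / 2) * (frullaniIntegrand (m + 1) ((m - 1 : ℝ) : ℂ) k).re - Real.exp (-m * k) := by
  have e : frullaniIntegrand (m + 1) ((m - 1 : ℝ) : ℂ) k =
      (((Real.exp (-((m - 1) * k)) - Real.exp (-((m + 1) * k))) / k : ℝ) : ℂ) := by
    unfold frullaniIntegrand; push_cast; rfl
  rw [e, Complex.ofReal_re, Real.sinh_eq,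
    show -((m - 1) * k) = -m * k + k by ring, show -((m + 1) * k) = -m * k + -k by ring,
    Real.exp_add, Real.exp_add]
  field_simp

lemma integrableOn_exp_mul_sinh_div {m : ℝ} (hm : 1 < m) :
    IntegrableOn (fun k => Real.exp (-m * k) * (Real.sinh k / k - 1)) (Ioi 0) := by
  have h1 := ((integrableOn_frullaniIntegrand (c := m + 1) (a := ((m - 1 : ℝ) : ℂ))
    (by linarith) (by simpa using hm)).re.const_mul (1 / 2)).sub
    (integrableOn_exp_mul_Ioi (a := -m) (by linarith) 0)
  refine IntegrableOn.congr_fun h1 (fun k hk => ?_) measurableSet_Ioi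
  simp only [Pi.sub_apply]
  exact (frullani_sinh_integrand m k (ne_of_gt hk)).symm

lemma integral_exp_mul_sinh_div {m : ℝ} (hm : 1 < m) :
    ∫ k in Ioi (0 : ℝ), Real.exp (-m * k) * (Real.sinh k / k - 1) =
      (Real.log (m + 1) - Real.log (m - 1)) / 2 - 1 / m := by
  have hi := integrableOn_frullaniIntegrand (c := m + 1) (a := ((m - 1 : ℝ) : ℂ))
    (by linarith) (by simpa using hm)
  have hre := hi.re
  have := integral_re hi
  simp only [RCLike.re_eq_complex_re] at this hre
  rw [setIntegral_congr_fun measurableSet_Ioi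
    (fun k hk => frullani_sinh_integrand m k (ne_of_gt hk)), integral_sub
    (hre.const_mul (1 / 2)) (integrableOn_exp_mul_Ioi (a := -m) (by linarith) 0),
    integral_const_mul]
  rw [this, integral_frullaniIntegrand (by linarith) (by simpa using hm),
    integral_exp_mul_Ioi (by linarith), Complex.sub_re, Complex.ofReal_re, Complex.log_ofReal_re]
  simp
  ring

/-- The real part of `exp (-(c - ix) k)` is `exp (-c k) cos (x k)`, so the cosine integral is
Frullani's integral at a complex parameter. -/
lemma frullani_cos_integrand (c x k : ℝ) :
    Real.exp (-c * k) * ((1 - Real.cos (x * k)) / k) =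
      -(frullaniIntegrand c (c - x * Complex.I) k).re := by
  unfold frullaniIntegrand
  rw [Complex.div_ofReal_re, Complex.sub_re, Complex.exp_re, Complex.exp_re]
  simp
  ring

lemma integrableOn_exp_mul_one_sub_cos {c : ℝ} (hc : 0 < c) (x : ℝ) :
    IntegrableOn (fun k => Real.exp (-c * k) * ((1 - Real.cos (x * k)) / k)) (Ioi 0) := by
  simp only [frullani_cos_integrand]
  exact (integrableOn_frullaniIntegrand hc (by simpa using hc)).re.neg

lemma integral_exp_mul_one_sub_cos {c : ℝ} (hc : 0 < c) (x : ℝ) :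
    ∫ k in Ioi (0 : ℝ), Real.exp (-c * k) * ((1 - Real.cos (x * k)) / k) =
      Real.log (1 + x ^ 2 / c ^ 2) / 2 := by
  have ha : 0 < (c - x * Complex.I : ℂ).re := by simpa using hc
  simp only [frullani_cos_integrand]
  rw [integral_neg]
  have := integral_re (integrableOn_frullaniIntegrand hc ha)
  simp only [RCLike.re_eq_complex_re] at this
  rw [this, integral_frullaniIntegrand hc ha, Complex.sub_re, Complex.ofReal_re, Complex.log_re]
  have e : ‖(c - x * Complex.I : ℂ)‖ = √(c ^ 2 + x ^ 2) := by
    rw [Complex.norm_def, Complex.normSq_apply]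
    simp
    ring_nf
  rw [e, Real.log_sqrt (by positivity), show 1 + x ^ 2 / c ^ 2 = (c ^ 2 + x ^ 2) / c ^ 2 by
    field_simp, Real.log_div (by positivity) (by positivity), Real.log_pow]
  push_cast
  ring

/-! ### Decay of the phase factor on the line `Im z = -1`. -/

lemma rePhase_zero_sub_eq_integral {t x : ℝ} (ht0 : 0 ≤ t) (ht1 : t ≤ 1) :
    rePhase t ((0 : ℝ) - Complex.I * (1 : ℝ)) - rePhase t (x - Complex.I * (1 : ℝ)) =
      ∫ k in Ioi (0 : ℝ), halfWeight t k * ((1 - Real.cos (x * k)) / k) / (2 * Real.sinh k) := by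
  rw [rePhase_eq_integral ht0 ht1 (by simp), rePhase_eq_integral ht0 ht1 (by simp),
    ← integral_sub (integrableOn_rePhase_integrand ht0 ht1 (by simp))
      (integrableOn_rePhase_integrand ht0 ht1 (by simp))]
  refine setIntegral_congr_fun measurableSet_Ioi fun k hk => ?_
  have hk : 0 < k := hk
  have hs : 0 < Real.sinh k := Real.sinh_pos_iff.2 hk
  simp only [cosh_two_mul_sub_one, one_mul, zero_mul, Real.cos_zero]
  field_simp
  ring

lemma integrableOn_rePhase_zero_sub {t x : ℝ} (ht0 : 0 ≤ t) (ht1 : t ≤ 1) :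
    IntegrableOn
      (fun k => halfWeight t k * ((1 - Real.cos (x * k)) / k) / (2 * Real.sinh k)) (Ioi 0) := by
  refine ((integrableOn_rePhase_integrand (x := 0) (s := 1) ht0 ht1 (by simp)).sub
      (integrableOn_rePhase_integrand (x := x) (s := 1) ht0 ht1 (by simp))).congr_fun
      (fun k hk => ?_) measurableSet_Ioi
  have hk : 0 < k := hk
  have hs : 0 < Real.sinh k := Real.sinh_pos_iff.2 hk
  simp only [cosh_two_mul_sub_one, one_mul, zero_mul, Real.cos_zero, Pi.sub_apply]
  field_simp
  ring

/-- Decay of `|e^{θ}|` on the line `Im z = -1`, uniformly in `t`. -/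
lemma rePhase_le_sub_log {t x : ℝ} (ht0 : 0 ≤ t) (ht1 : t ≤ 1) :
    rePhase t (x - Complex.I * (1 : ℝ)) ≤ 96 - Real.log (1 + x ^ 2 / 4) := by
  have h0 := rePhase_zero_le (s := 1) ht0 ht1 zero_le_one le_rfl
  have h1 := rePhase_zero_sub_eq_integral (x := x) ht0 ht1
  -- The comparison function is the Frullani integrand with `c = 2`, since `2 exp (-2k) * 2 sinh k ≤
  -- 2 exp (-k)` lies below the weight. The prefactor `2` yields a full logarithm, hence decay `x⁻⁴`
  -- of `exp (2 Re θ)`.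
  have h2 : Real.log (1 + x ^ 2 / 4) =
      ∫ k in Ioi (0 : ℝ), 2 * (Real.exp (-2 * k) * ((1 - Real.cos (x * k)) / k)) := by
    rw [integral_const_mul, integral_exp_mul_one_sub_cos two_pos]
    norm_num
    ring
  have h3 : Real.log (1 + x ^ 2 / 4) ≤
      ∫ k in Ioi (0 : ℝ), halfWeight t k * ((1 - Real.cos (x * k)) / k) / (2 * Real.sinh k) := by
    rw [h2]
    refine setIntegral_mono_on ((integrableOn_exp_mul_one_sub_cos two_pos x).const_mul 2)
      (integrableOn_rePhase_zero_sub ht0 ht1) measurableSet_Ioi fun k hk => ?_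
    have hk : 0 < k := hk
    have hs : 0 < Real.sinh k := Real.sinh_pos_iff.2 hk
    rw [le_div_iff₀ (by positivity)]
    have h5 : 0 ≤ (1 - Real.cos (x * k)) / k :=
      div_nonneg (by linarith [Real.cos_le_one (x * k)]) hk.le
    have h6 : 2 * Real.exp (-2 * k) * (2 * Real.sinh k) ≤ halfWeight t k := by
      refine le_trans ?_ (two_mul_exp_neg_le_halfWeight hk.le)
      rw [Real.sinh_eq]
      have e : Real.exp (-k) = Real.exp (-2 * k) * Real.exp k := by
        rw [← Real.exp_add]; ring_nf
      rw [e]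
      have := Real.exp_pos (-2 * k)
      nlinarith [Real.exp_pos (-2 * k), Real.exp_pos k,
        mul_pos this (mul_pos this (Real.exp_pos k))]
    calc 2 * (Real.exp (-2 * k) * ((1 - Real.cos (x * k)) / k)) * (2 * Real.sinh k)
        = 2 * Real.exp (-2 * k) * (2 * Real.sinh k) * ((1 - Real.cos (x * k)) / k) := by ring
      _ ≤ _ := by gcongr
  linarith

lemma exp_two_mul_rePhase_le {t x : ℝ} (ht0 : 0 ≤ t) (ht1 : t ≤ 1) :
    Real.exp (2 * rePhase t (x - Complex.I * (1 : ℝ))) ≤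
      Real.exp 192 / (1 + x ^ 2 / 4) ^ 2 := by
  have h := rePhase_le_sub_log (x := x) ht0 ht1
  have e : Real.exp 192 / (1 + x ^ 2 / 4) ^ 2 =
      Real.exp (192 - 2 * Real.log (1 + x ^ 2 / 4)) := by
    rw [Real.exp_sub, two_mul, Real.exp_add, Real.exp_log (by positivity)]
    ring
  rw [e]
  exact Real.exp_le_exp.2 (by linarith)

/-! ### The phase as an absolutely convergent integral -/

lemma integrableOn_Iic_neg_iff {E : Type*} [NormedAddCommGroup E] {f : ℝ → E} {c : ℝ} :
    IntegrableOn f (Iic (-c)) ↔ IntegrableOn (fun k => f (-k)) (Ici c) := by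
  have m : MeasurableEmbedding fun x : ℝ => -x := (Homeomorph.neg ℝ).measurableEmbedding
  rw [← Measure.map_neg_eq_self (volume : Measure ℝ), m.integrableOn_map_iff,
    Measure.map_neg_eq_self]
  simp [Function.comp_def]

lemma integrable_exp_neg_half_abs :
    Integrable (fun k : ℝ => Real.exp (-(1 / 2) * |k|)) := by
  have h1 : IntegrableOn (fun k : ℝ => Real.exp (-(1 / 2) * |k|)) (Ioi 0) := by
    refine (integrableOn_exp_mul_Ioi (a := -(1 / 2)) (by norm_num) 0).congr_fun (fun k hk => ?_)
      measurableSet_Ioi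
    have hk : 0 < k := hk
    simp only [abs_of_pos hk]
  have h2 : IntegrableOn (fun k : ℝ => Real.exp (-(1 / 2) * |k|)) (Iic 0) := by
    rw [← neg_zero, integrableOn_Iic_neg_iff]
    simp only [abs_neg]
    exact Iff.mpr integrableOn_Ici_iff_integrableOn_Ioi h1
  rw [← integrableOn_univ, ← Iic_union_Ioi (a := (0 : ℝ))]
  exact h2.union h1

lemma measurable_phaseIntegrand (γ : ℝ) (z : ℂ) : Measurable (phaseIntegrand γ z) := by
  unfold phaseIntegrand weight
  fun_prop

lemma norm_phaseIntegrand_le {γ : ℝ} (hγ : 2 < γ) {z : ℂ} (hz : |z.im| ≤ 1) {ε k : ℝ}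
    (hε : 0 < ε) (hk : ε ≤ |k|) :
    ‖phaseIntegrand γ z k‖ ≤
      96 * Real.pi * (1 + ‖z‖) / ε ^ 3 * Real.exp (-(1 / 2) * |k|) := by
  have hk0 : 0 < |k| := hε.trans_le hk
  have ht0 : 0 ≤ 2 / γ := by positivity
  have ht1 : 2 / γ ≤ 1 := by rw [div_le_one (by linarith)]; exact hγ.le
  have hw0 : 0 ≤ halfWeight (2 / γ) |k| := halfWeight_nonneg hk0.le
  have hw := halfWeight_le ht0 ht1 hk0.le
  have hs : 0 < Real.sinh |k| := Real.sinh_pos_iff.2 hk0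
  have hsq : Real.sinh k ^ 2 = Real.sinh |k| ^ 2 := by
    rcases abs_choice k with h | h <;> rw [h]
    rw [Real.sinh_neg]; ring
  have hnum : ‖Complex.exp (Complex.I * z * k) - Complex.I * z * k‖ ≤
      (1 + ‖z‖) * Real.exp |k| := by
    refine (norm_sub_le _ _).trans ?_
    have h1 : ‖Complex.exp (Complex.I * z * k)‖ ≤ Real.exp |k| := by
      rw [Complex.norm_exp, Real.exp_le_exp]
      have : (Complex.I * z * k).re = -z.im * k := by simp
      rw [this]
      refine (le_abs_self _).trans ?_
      rw [abs_mul, abs_neg]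
      nlinarith
    have h2 : ‖Complex.I * z * k‖ ≤ ‖z‖ * Real.exp |k| := by
      rw [norm_mul, norm_mul, Complex.norm_I, one_mul, Complex.norm_real, Real.norm_eq_abs]
      have := Real.add_one_le_exp |k|
      gcongr
      linarith
    linarith
  unfold phaseIntegrand
  rw [norm_div, norm_mul, Complex.norm_real, Complex.norm_real, weight_eq, cosh_two_mul_sub_one,
    hsq, Real.norm_of_nonneg (by positivity), norm_mul, Real.norm_eq_abs k,
    Real.norm_of_nonneg (by positivity : 0 ≤ 2 * Real.sinh |k| ^ 2),
    div_le_iff₀ (by positivity)]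
  have h3 := le_exp_mul_sinh hk0.le
  -- Without symmetrisation the integrand is of order `k⁻³` at the origin; this is paid for by `ε ^
  -- 3 ≤ |k| ^ 3`.
  have h4 : ε ^ 3 * Real.exp |k| ≤
      64 * Real.exp (-(1 / 2) * |k|) * (|k| * Real.sinh |k| ^ 2) := by
    calc ε ^ 3 * Real.exp |k| ≤ |k| ^ 3 * Real.exp |k| := by gcongr
      _ = |k| * |k| ^ 2 * Real.exp |k| := by ring
      _ ≤ |k| * (8 * Real.exp (-(3 / 4) * |k|) * Real.sinh |k|) ^ 2 * Real.exp |k| := by gcongr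
      _ = 64 * (Real.exp (-(3 / 4) * |k|) * Real.exp (-(3 / 4) * |k|) * Real.exp |k|) *
          (|k| * Real.sinh |k| ^ 2) := by ring
      _ = _ := by rw [← Real.exp_add, ← Real.exp_add]; ring_nf
  have hpi := Real.pi_pos
  calc Real.pi * halfWeight (2 / γ) |k| *
        ‖Complex.exp (Complex.I * z * k) - Complex.I * z * k‖
      ≤ Real.pi * 3 * ((1 + ‖z‖) * Real.exp |k|) := by gcongr
    _ = 3 * Real.pi * (1 + ‖z‖) / ε ^ 3 * (ε ^ 3 * Real.exp |k|) := by
        field_simp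
    _ ≤ 3 * Real.pi * (1 + ‖z‖) / ε ^ 3 *
        (64 * Real.exp (-(1 / 2) * |k|) * (|k| * Real.sinh |k| ^ 2)) := by gcongr
    _ = _ := by ring

lemma measurableSet_le_abs (ε : ℝ) : MeasurableSet {k : ℝ | ε ≤ |k|} :=
  measurableSet_le measurable_const measurable_norm

lemma integrableOn_phaseIntegrand {γ : ℝ} (hγ : 2 < γ) {z : ℂ} (hz : |z.im| ≤ 1) {ε : ℝ}
    (hε : 0 < ε) : IntegrableOn (phaseIntegrand γ z) {k : ℝ | ε ≤ |k|} := by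
  refine Integrable.mono' (integrable_exp_neg_half_abs.integrableOn.const_mul
    (96 * Real.pi * (1 + ‖z‖) / ε ^ 3)) (measurable_phaseIntegrand γ z).aestronglyMeasurable ?_
  filter_upwards [ae_restrict_mem (measurableSet_le_abs ε)] with k hk
  exact norm_phaseIntegrand_le hγ hz hε hk

/-- Since the denominator is odd, the even part of the exponential cancels and only `sin (zk) - zk`
survives. -/
lemma phaseIntegrand_add_neg (γ : ℝ) (z : ℂ) {k : ℝ} (hk : 0 < k) :
    phaseIntegrand γ z k + phaseIntegrand γ z (-k) =
      (2 * Real.pi * Complex.I) * halfIntegrand (2 / γ) z k := by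
  unfold phaseIntegrand halfIntegrand
  rw [weight_eq, weight_eq, abs_neg, abs_of_pos hk, mul_neg 2 k, Real.cosh_neg, Complex.sin]
  have hs : Complex.sinh k ≠ 0 := by exact_mod_cast (Real.sinh_pos_iff.2 hk).ne'
  have hk' : (k : ℂ) ≠ 0 := by exact_mod_cast hk.ne'
  rw [cosh_two_mul_sub_one]
  have e1 : Complex.I * z * ((-k : ℝ) : ℂ) = -(z * k) * Complex.I := by push_cast; ring
  have e2 : Complex.I * z * k = z * k * Complex.I := by ring
  rw [e1, e2]
  push_cast
  field_simp
  linear_combination (halfWeight (2 / γ) k : ℂ) *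
    (Complex.exp (z * k * Complex.I) - Complex.exp (-(z * k * Complex.I))) * Complex.I_sq

lemma truncatedPhase_eq {γ : ℝ} (hγ : 2 < γ) {z : ℂ} (hz : |z.im| ≤ 1) {ε : ℝ} (hε : 0 < ε) :
    truncatedPhase γ z ε = Complex.I * ∫ k in Ioi ε, halfIntegrand (2 / γ) z k := by
  have hset : {k : ℝ | ε ≤ |k|} = Iic (-ε) ∪ Ici ε := by
    ext k; simp only [mem_ofPred_eq, le_abs, mem_union, mem_Iic, mem_Ici]
    constructor
    · rintro (h | h)
      · exact Or.inr h
      · exact Or.inl (by linarith)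
    · rintro (h | h)
      · exact Or.inr (by linarith)
      · exact Or.inl h
  have hi := integrableOn_phaseIntegrand hγ hz hε
  rw [hset] at hi
  have hdisj : Disjoint (Iic (-ε)) (Ici ε) := by
    rw [Set.disjoint_left]
    intro k h1 h2
    have h1 : k ≤ -ε := h1
    have h2 : ε ≤ k := h2
    linarith
  have hL := hi.left_of_union
  have hR := hi.right_of_union
  have hneg : IntegrableOn (fun k => phaseIntegrand γ z (-k)) (Ioi ε) := by
    have : IntegrableOn (fun k => phaseIntegrand γ z (-k)) (Ici ε) := by
      exact integrableOn_Iic_neg_iff.1 hL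
    exact this.mono_set Ioi_subset_Ici_self
  unfold truncatedPhase
  rw [hset, setIntegral_union hdisj measurableSet_Ici hL hR, integral_Ici_eq_integral_Ioi]
  have h1 : ∫ k in Iic (-ε), phaseIntegrand γ z k = ∫ k in Ioi ε, phaseIntegrand γ z (-k) := by
    simpa only [neg_neg] using integral_comp_neg_Iic (-ε) (fun k => phaseIntegrand γ z (-k))
  rw [h1, add_comm, ← integral_add (hR.mono_set Ioi_subset_Ici_self) hneg,
    setIntegral_congr_fun measurableSet_Ioi
      (fun k hk => phaseIntegrand_add_neg γ z (hε.trans hk)), integral_const_mul]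
  have : (Real.pi : ℂ) ≠ 0 := by exact_mod_cast Real.pi_ne_zero
  field_simp

lemma tendsto_truncatedPhase {γ : ℝ} (hγ : 2 < γ) {z : ℂ} (hz : |z.im| ≤ 1) :
    Tendsto (truncatedPhase γ z) (𝓝[>] (0 : ℝ)) (𝓝 (Complex.I * halfPhase (2 / γ) z)) := by
  have ht0 : 0 ≤ 2 / γ := by positivity
  have ht1 : 2 / γ ≤ 1 := by rw [div_le_one (by linarith)]; exact hγ.le
  have hcov : AECover (volume.restrict (Ioi (0 : ℝ))) (𝓝[>] (0 : ℝ)) fun ε : ℝ => Ioi ε :=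
    aecover_Ioi_of_Ioi (tendsto_id.mono_left nhdsWithin_le_nhds)
  have h := hcov.integral_tendsto_of_countably_generated (integrableOn_halfIntegrand ht0 ht1 hz)
  have h2 := h.const_mul Complex.I
  refine h2.congr' ?_
  filter_upwards [self_mem_nhdsWithin] with ε hε
  have hε : 0 < ε := hε
  rw [truncatedPhase_eq hγ hz hε, Measure.restrict_restrict measurableSet_Ioi,
    Ioi_inter_Ioi, max_eq_left hε.le]

lemma phase_eq {γ : ℝ} (hγ : 2 < γ) {z : ℂ} (hz : |z.im| ≤ 1) :
    phase γ z = Complex.I * halfPhase (2 / γ) z :=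
  (tendsto_truncatedPhase hγ hz).limUnder_eq

/-! ### The optimizer on horizontal lines -/

/-- `|B_γ(x - i s)|²` with `t = 2 / γ`. -/
def blaschkeSq (t s x : ℝ) : ℝ := (x ^ 2 + (2 - t + s) ^ 2) / (x ^ 2 + (2 - t - s) ^ 2)

lemma two_div_mem {γ : ℝ} (hγ : 2 < γ) : 0 < 2 / γ ∧ 2 / γ < 1 :=
  ⟨by positivity, by rw [div_lt_one (by linarith)]; exact hγ⟩

lemma norm_blaschke_sq (γ x s : ℝ) :
    ‖blaschke γ (x - Complex.I * s)‖ ^ 2 = blaschkeSq (2 / γ) s x := by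
  unfold blaschke blaschkeZero blaschkeSq
  rw [Complex.sq_norm, Complex.normSq_div, Complex.normSq_apply, Complex.normSq_apply]
  simp only [map_mul, Complex.conj_I, Complex.conj_ofReal, Complex.sub_re, Complex.sub_im,
    Complex.mul_re, Complex.mul_im, Complex.neg_re, Complex.neg_im, Complex.I_re, Complex.I_im,
    Complex.ofReal_re, Complex.ofReal_im]
  congr 1 <;> ring

lemma norm_optimizer_sq {γ x s : ℝ} (hγ : 2 < γ) (hs : |s| ≤ 1) :
    ‖optimizer γ (x - Complex.I * s)‖ ^ 2 =
      blaschkeSq (2 / γ) s x * Real.exp (2 * rePhase (2 / γ) (x - Complex.I * s)) := by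
  unfold optimizer
  rw [norm_mul, mul_pow, norm_blaschke_sq, Complex.norm_exp, phase_eq hγ (by simpa using hs),
    ← Real.exp_nat_mul]
  rfl

lemma onLine_neg (h : ℂ → ℂ) (s x : ℝ) : onLine h (-s) x = h (x - Complex.I * s) := by
  unfold onLine
  push_cast
  ring_nf

/-- A quotient `(x² + A) / (x² + B)` with `A ≥ B > 0` is largest at `x = 0`. -/
lemma blaschkeSq_le {t s x : ℝ} (ht1 : t < 1) (hs0 : 0 ≤ s) (hs1 : s ≤ 1) :
    blaschkeSq t s x ≤ blaschkeSq t s 0 := by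
  unfold blaschkeSq
  have h : 0 < (2 - t - s) ^ 2 := by have : 0 < 2 - t - s := by linarith
                                     positivity
  rw [div_le_div_iff₀ (by positivity) (by positivity)]
  have h2 : (2 - t - s) ^ 2 ≤ (2 - t + s) ^ 2 := by nlinarith
  nlinarith [mul_le_mul_of_nonneg_left h2 (sq_nonneg x)]

lemma blaschkeSq_zero_le {t s : ℝ} (ht0 : 0 ≤ t) (ht1 : t < 1) (hs0 : 0 ≤ s) (hs1 : s ≤ 1) :
    blaschkeSq t s 0 ≤ 9 / (1 - t) ^ 2 := by
  unfold blaschkeSq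
  have : 0 < 1 - t := by linarith
  have h1 : (0 : ℝ) ^ 2 + (2 - t + s) ^ 2 ≤ 9 := by nlinarith
  have h2 : (1 - t) ^ 2 ≤ (0 : ℝ) ^ 2 + (2 - t - s) ^ 2 := by nlinarith
  gcongr

lemma norm_optimizer_le_zero {γ x s : ℝ} (hγ : 2 < γ) (hs0 : 0 ≤ s) (hs1 : s ≤ 1) :
    ‖optimizer γ (x - Complex.I * s)‖ ≤ ‖optimizer γ ((0 : ℝ) - Complex.I * s)‖ := by
  obtain ⟨ht0, ht1⟩ := two_div_mem hγ
  have hs : |s| ≤ 1 := by rwa [abs_of_nonneg hs0]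
  refine le_of_sq_le_sq ?_ (norm_nonneg _)
  rw [norm_optimizer_sq hγ hs, norm_optimizer_sq hγ hs]
  have h1 := blaschkeSq_le (x := x) ht1 hs0 hs1
  have h2 := rePhase_le_rePhase_zero (x := x) ht0.le ht1.le hs0 hs1
  have h3 : 0 ≤ blaschkeSq (2 / γ) s 0 := by unfold blaschkeSq; positivity
  gcongr

lemma norm_optimizer_sq_le {γ x s : ℝ} (hγ : 2 < γ) (hs0 : 0 ≤ s) (hs1 : s ≤ 1) :
    ‖optimizer γ (x - Complex.I * s)‖ ^ 2 ≤ 9 / (1 - 2 / γ) ^ 2 * Real.exp 192 := by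
  obtain ⟨ht0, ht1⟩ := two_div_mem hγ
  have hs : |s| ≤ 1 := by rwa [abs_of_nonneg hs0]
  refine (pow_le_pow_left₀ (norm_nonneg _) (norm_optimizer_le_zero hγ hs0 hs1) 2).trans ?_
  rw [norm_optimizer_sq hγ hs]
  have h1 := blaschkeSq_zero_le ht0.le ht1 hs0 hs1
  have h2 := rePhase_zero_le ht0.le ht1.le hs0 hs1
  have h3 : 2 * rePhase (2 / γ) ((0 : ℝ) - Complex.I * s) ≤ 192 := by linarith
  gcongr

lemma continuousOn_optimizer {γ : ℝ} (hγ : 2 < γ) :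
    ContinuousOn (optimizer γ) {z | -1 ≤ z.im ∧ z.im ≤ 0} := by
  obtain ⟨ht0, ht1⟩ := two_div_mem hγ
  have him : ∀ z : ℂ, -1 ≤ z.im ∧ z.im ≤ 0 → |z.im| ≤ 1 := fun z hz =>
    abs_le.2 ⟨hz.1, hz.2.trans zero_le_one⟩
  refine ContinuousOn.mul ?_ (ContinuousOn.cexp ?_)
  · refine ContinuousOn.div (by fun_prop) (by fun_prop) fun z hz h0 => ?_
    have := congrArg Complex.im h0
    simp only [blaschkeZero, Complex.sub_im, map_mul, Complex.conj_I, Complex.conj_ofReal,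
      Complex.mul_im, Complex.neg_re, Complex.neg_im, Complex.I_re, Complex.I_im,
      Complex.ofReal_re, Complex.ofReal_im, Complex.zero_im] at this
    have := hz.1
    linarith
  · refine ContinuousOn.congr (f := fun z => Complex.I * halfPhase (2 / γ) z) ?_
      fun z hz => phase_eq hγ (him z hz)
    refine continuousOn_const.mul (continuousOn_halfPhase.comp (f := fun z : ℂ => (2 / γ, z))
      (by fun_prop) fun z hz => ?_)
    exact ⟨⟨ht0.le, ht1.le⟩, him z hz⟩

lemma continuous_onLine_optimizer {γ s : ℝ} (hγ : 2 < γ) (hs0 : 0 ≤ s) (hs1 : s ≤ 1) :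
    Continuous (onLine (optimizer γ) (-s)) := by
  unfold onLine
  refine (continuousOn_optimizer hγ).comp_continuous (by fun_prop) fun x => ?_
  simp [hs0, hs1]

lemma norm_onLine_optimizer_le {γ s : ℝ} (hγ : 2 < γ) (hs0 : 0 ≤ s) (hs1 : s ≤ 1) (x : ℝ) :
    ‖onLine (optimizer γ) (-s) x‖ ≤ √(9 / (1 - 2 / γ) ^ 2 * Real.exp 192) := by
  rw [onLine_neg]
  exact Real.le_sqrt_of_sq_le (norm_optimizer_sq_le hγ hs0 hs1)

/-- The optimizer is continuous up to the boundary of the strip and bounded there uniformly in the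
height, so dominated convergence against a Schwartz function applies. -/
lemma isBoundaryValue_optimizer {γ s : ℝ} (hγ : 2 < γ) (hs0 : 0 ≤ s) (hs1 : s ≤ 1) :
    IsBoundaryValue (optimizer γ) (-s) (onLine (optimizer γ) (-s)) := by
  intro φ
  refine tendsto_integral_filter_of_dominated_convergence
    (fun x => √(9 / (1 - 2 / γ) ^ 2 * Real.exp 192) * ‖φ x‖) ?_ ?_ ?_ ?_
  · filter_upwards [self_mem_nhdsWithin] with y hy
    have h := continuous_onLine_optimizer (s := -y) hγ (by linarith [hy.2]) (by linarith [hy.1])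
    rw [neg_neg] at h
    exact (h.mul φ.continuous).aestronglyMeasurable
  · filter_upwards [self_mem_nhdsWithin] with y hy
    refine Eventually.of_forall fun x => ?_
    have h := norm_onLine_optimizer_le (s := -y) hγ (by linarith [hy.2]) (by linarith [hy.1]) x
    rw [neg_neg] at h
    rw [norm_mul]
    gcongr
  · exact (φ.integrable.norm).const_mul _
  · refine Eventually.of_forall fun x => Tendsto.mul_const _ ?_
    have hc := continuousOn_optimizer hγ (x + Complex.I * ((-s : ℝ) : ℂ)) (by simp [hs0, hs1])
    refine Tendsto.comp hc (tendsto_nhdsWithin_iff.2 ⟨?_, ?_⟩)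
    · have : Continuous fun y : ℝ => (x + Complex.I * y : ℂ) := by fun_prop
      exact (this.tendsto (-s)).mono_left nhdsWithin_le_nhds
    · filter_upwards [self_mem_nhdsWithin] with y hy
      simp [hy.1.le, hy.2.le]

/-! ### The three norms of the optimizer. -/

lemma lpNormReal_top_eq {f : ℝ → ℂ} (hf : Continuous f) (hle : ∀ x, ‖f x‖ ≤ ‖f 0‖) :
    lpNormReal ∞ f = ‖f 0‖ := by
  unfold lpNormReal
  rw [eLpNorm_exponent_top]
  have h1 : eLpNormEssSup f volume ≤ ‖f 0‖ₑ :=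
    eLpNormEssSup_le_of_ae_enorm_bound (Eventually.of_forall fun x => by
      rw [enorm_le_iff_norm_le]; exact hle x)
  have h2 : ‖f 0‖ₑ ≤ eLpNormEssSup f volume := by
    -- The set where the norm is at most the essential supremum has full measure, hence is dense; by
    -- continuity it is closed, so it contains `0`.
    have hd : Dense {x : ℝ | ‖f x‖ₑ ≤ eLpNormEssSup f volume} :=
      Measure.dense_of_ae (ae_le_eLpNormEssSup (f := f) (μ := volume))
    have hc : IsClosed {x : ℝ | ‖f x‖ₑ ≤ eLpNormEssSup f volume} :=
      isClosed_le hf.enorm continuous_const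
    have := hc.closure_eq ▸ hd.closure_eq
    have h0 : (0 : ℝ) ∈ {x : ℝ | ‖f x‖ₑ ≤ eLpNormEssSup f volume} := by
      rw [this]; trivial
    exact h0
  rw [le_antisymm h1 h2, toReal_enorm]

lemma memLp_top_onLine_optimizer {γ s : ℝ} (hγ : 2 < γ) (hs0 : 0 ≤ s) (hs1 : s ≤ 1) :
    MemLp (onLine (optimizer γ) (-s)) ∞ volume :=
  memLp_top_of_bound (continuous_onLine_optimizer hγ hs0 hs1).aestronglyMeasurable _
    (Eventually.of_forall (norm_onLine_optimizer_le hγ hs0 hs1))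

lemma lpNormReal_top_optimizer {γ s : ℝ} (hγ : 2 < γ) (hs0 : 0 ≤ s) (hs1 : s ≤ 1) :
    lpNormReal ∞ (onLine (optimizer γ) (-s)) =
      (2 - 2 / γ + s) / (2 - 2 / γ - s) *
        Real.exp (rePhase (2 / γ) ((0 : ℝ) - Complex.I * s)) := by
  obtain ⟨ht0, ht1⟩ := two_div_mem hγ
  have hs : |s| ≤ 1 := by rwa [abs_of_nonneg hs0]
  rw [lpNormReal_top_eq (continuous_onLine_optimizer hγ hs0 hs1)]
  · rw [onLine_neg]
    have h2 : 0 < 2 - 2 / γ - s := by linarith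
    refine (pow_left_inj₀ (norm_nonneg _) ?_ two_ne_zero).1 ?_
    · have : 0 < 2 - 2 / γ + s := by linarith
      positivity
    · rw [norm_optimizer_sq hγ hs, mul_pow, ← Real.exp_nat_mul, blaschkeSq, div_pow]
      norm_num
  · intro x
    rw [onLine_neg, onLine_neg]
    exact norm_optimizer_le_zero hγ hs0 hs1

/-- `‖h_{-1}‖₂²` as a function of `t = 2 / γ`. -/
def lineNormSq (t : ℝ) : ℝ :=
  ∫ x : ℝ, blaschkeSq t 1 x * Real.exp (2 * rePhase t (x - Complex.I * (1 : ℝ)))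

lemma continuous_rePhase {t s : ℝ} (ht0 : 0 ≤ t) (ht1 : t ≤ 1) (hs : |s| ≤ 1) :
    Continuous fun x : ℝ => rePhase t (x - Complex.I * s) := by
  refine continuousOn_rePhase.comp_continuous
    (f := fun x : ℝ => ((t, x - Complex.I * s) : ℝ × ℂ)) (by fun_prop) fun x => ?_
  exact ⟨⟨ht0, ht1⟩, by simpa using hs⟩

lemma continuous_blaschkeSq {t : ℝ} (ht1 : t < 1) : Continuous (blaschkeSq t 1) := by
  unfold blaschkeSq
  refine Continuous.div (by fun_prop) (by fun_prop) fun x => ?_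
  have : 0 < 2 - t - 1 := by linarith
  positivity

lemma lineNormSq_integrand_le {t : ℝ} (ht0 : 0 ≤ t) (ht1 : t < 1) (x : ℝ) :
    blaschkeSq t 1 x * Real.exp (2 * rePhase t (x - Complex.I * (1 : ℝ))) ≤
      9 / (1 - t) ^ 2 * (4 * Real.exp 192) * (1 + x ^ 2)⁻¹ := by
  have h1 := (blaschkeSq_le (x := x) ht1 zero_le_one le_rfl).trans
    (blaschkeSq_zero_le ht0 ht1 zero_le_one le_rfl)
  have h2 := exp_two_mul_rePhase_le (x := x) ht0 ht1.le
  have h3 : Real.exp 192 / (1 + x ^ 2 / 4) ^ 2 ≤ 4 * Real.exp 192 * (1 + x ^ 2)⁻¹ := by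
    rw [div_le_iff₀ (by positivity), mul_assoc, mul_comm (_⁻¹), ← div_eq_mul_inv, mul_comm 4,
      mul_assoc]
    refine le_mul_of_one_le_right (Real.exp_pos _).le ?_
    rw [← mul_div_assoc, one_le_div (by positivity)]
    nlinarith [sq_nonneg x, sq_nonneg (x ^ 2)]
  calc _ ≤ 9 / (1 - t) ^ 2 * (4 * Real.exp 192 * (1 + x ^ 2)⁻¹) :=
        mul_le_mul h1 (h2.trans h3) (Real.exp_pos _).le (by positivity)
    _ = _ := by ring

lemma blaschkeSq_nonneg (t s x : ℝ) : 0 ≤ blaschkeSq t s x := by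
  unfold blaschkeSq; positivity

lemma continuous_lineNormSq_integrand {t : ℝ} (ht0 : 0 ≤ t) (ht1 : t < 1) :
    Continuous fun x : ℝ =>
      blaschkeSq t 1 x * Real.exp (2 * rePhase t (x - Complex.I * (1 : ℝ))) :=
  (continuous_blaschkeSq ht1).mul
    (Real.continuous_exp.comp (continuous_const.mul (continuous_rePhase ht0 ht1.le (by simp))))

lemma integrable_lineNormSq {t : ℝ} (ht0 : 0 ≤ t) (ht1 : t < 1) :
    Integrable fun x : ℝ =>
      blaschkeSq t 1 x * Real.exp (2 * rePhase t (x - Complex.I * (1 : ℝ))) := by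
  refine Integrable.mono' (integrable_inv_one_add_sq.const_mul
    (9 / (1 - t) ^ 2 * (4 * Real.exp 192)))
    (continuous_lineNormSq_integrand ht0 ht1).aestronglyMeasurable
    (Eventually.of_forall fun x => ?_)
  rw [Real.norm_of_nonneg (mul_nonneg (blaschkeSq_nonneg _ _ _) (Real.exp_pos _).le)]
  exact lineNormSq_integrand_le ht0 ht1 x

lemma memLp_two_onLine_optimizer {γ : ℝ} (hγ : 2 < γ) :
    MemLp (onLine (optimizer γ) (-1)) 2 volume := by
  obtain ⟨ht0, ht1⟩ := two_div_mem hγ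
  rw [memLp_two_iff_integrable_sq_norm
    (continuous_onLine_optimizer hγ zero_le_one le_rfl).aestronglyMeasurable]
  simp_rw [onLine_neg, norm_optimizer_sq hγ (by simp : |(1 : ℝ)| ≤ 1)]
  exact integrable_lineNormSq ht0.le ht1

lemma lpNormReal_two_sq {γ : ℝ} (hγ : 2 < γ) :
    lpNormReal 2 (onLine (optimizer γ) (-1)) ^ 2 = lineNormSq (2 / γ) := by
  unfold lpNormReal
  rw [(memLp_two_onLine_optimizer hγ).eLpNorm_eq_integral_rpow_norm two_ne_zero (by simp),
    ENNReal.toReal_ofReal (by positivity)]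
  simp only [ENNReal.toReal_ofNat, Real.rpow_two]
  rw [← Real.rpow_mul_natCast (by positivity)]
  norm_num
  simp_rw [onLine_neg, norm_optimizer_sq hγ (by simp : |(1 : ℝ)| ≤ 1)]
  rfl

lemma threeLinesRatio_eq {γ : ℝ} (hγ : 2 < γ) :
    threeLinesRatio γ (optimizer γ) =
      ((1 - 2 / γ)⁻¹ * Real.exp (rePhase (2 / γ) ((0 : ℝ) - Complex.I * ((2 / γ : ℝ) : ℂ)))) ^ γ /
        lineNormSq (2 / γ) := by
  obtain ⟨ht0, ht1⟩ := two_div_mem hγ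
  unfold threeLinesRatio
  -- On the real line the Blaschke factor has modulus `1` and the phase vanishes at the origin.
  have h0 : lpNormReal ∞ (onLine (optimizer γ) 0) = 1 := by
    have := lpNormReal_top_optimizer (s := 0) hγ le_rfl zero_le_one
    rw [neg_zero] at this
    rw [this]
    have hp : rePhase (2 / γ) ((0 : ℝ) - Complex.I * (0 : ℝ)) = 0 := by
      have := abs_rePhase_le (z := (0 : ℝ) - Complex.I * (0 : ℝ)) ht0.le ht1.le (by simp)
      simpa using this
    rw [hp, Real.exp_zero, mul_one, add_zero, sub_zero, div_self (by linarith)]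
  rw [h0, Real.one_rpow, one_mul, lpNormReal_two_sq hγ,
    lpNormReal_top_optimizer hγ ht0.le ht1.le]
  congr 3
  have : 1 - 2 / γ ≠ 0 := by linarith
  rw [show 2 - 2 / γ - 2 / γ = 2 * (1 - 2 / γ) by ring]
  field_simp
  ring

/-! ### The closed form of the limit integrand -/

/-- For nonnegative terms, convergence of the partial sums of integrals already gives the
summability needed to integrate term by term. -/
lemma setIntegral_eq_of_hasSum_of_nonneg {s : Set ℝ} (hs : MeasurableSet s) {f : ℕ → ℝ → ℝ}
    {g : ℝ → ℝ} {L : ℝ} (hint : ∀ n, IntegrableOn (f n) s) (hnn : ∀ n, ∀ k ∈ s, 0 ≤ f n k)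
    (hL : Tendsto (fun N => ∑ n ∈ Finset.range N, ∫ k in s, f n k) atTop (𝓝 L))
    (hg : ∀ k ∈ s, HasSum (fun n => f n k) (g k)) : ∫ k in s, g k = L := by
  have h0 : ∀ n, 0 ≤ ∫ k in s, f n k := fun n => setIntegral_nonneg hs (hnn n)
  have hsum : HasSum (fun n => ∫ k in s, f n k) L := (hasSum_iff_tendsto_nat_of_nonneg h0 L).2 hL
  have h := hasSum_integral_of_summable_integral_norm hint (by
    refine hsum.summable.congr fun n => ?_
    refine setIntegral_congr_fun hs fun k hk => ?_
    exact (Real.norm_of_nonneg (hnn n k hk)).symm)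
  rw [← h.unique hsum]
  exact setIntegral_congr_fun hs fun k hk => (hg k hk).tsum_eq.symm

lemma tendsto_euler_sinh_prod {x : ℝ} (hx : x ≠ 0) :
    Tendsto (fun n : ℕ => ∏ j ∈ Finset.range n, (1 + x ^ 2 / ((j : ℝ) + 1) ^ 2)) atTop
      (𝓝 (Real.sinh (Real.pi * x) / (Real.pi * x))) := by
  have hpx : Real.pi * x ≠ 0 := mul_ne_zero Real.pi_ne_zero hx
  have h := Complex.tendsto_euler_sin_prod (x * Complex.I)
  have e1 : Complex.sin (Real.pi * (x * Complex.I)) =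
      ((Real.sinh (Real.pi * x) : ℝ) : ℂ) * Complex.I := by
    rw [← mul_assoc, Complex.sin_mul_I]; push_cast; rfl
  have h2 := (Complex.continuous_im.tendsto _).comp h
  rw [e1, Complex.im_ofReal_mul, Complex.I_im, mul_one] at h2
  refine (h2.div_const (Real.pi * x)).congr fun n => ?_
  have e2 : (Real.pi : ℂ) * (x * Complex.I) *
      ∏ j ∈ Finset.range n, (1 - (x * Complex.I) ^ 2 / ((j : ℂ) + 1) ^ 2) =
      ((Real.pi * x * ∏ j ∈ Finset.range n, (1 + x ^ 2 / ((j : ℝ) + 1) ^ 2) : ℝ) : ℂ) *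
        Complex.I := by
    push_cast
    simp only [mul_pow, Complex.I_sq]
    simp only [mul_neg, mul_one, neg_div, sub_neg_eq_add]
    ring
  simp only [Function.comp_apply]
  rw [e2, Complex.im_ofReal_mul, Complex.I_im, mul_one, mul_div_cancel_left₀ _ hpx]

/-- Splitting into odd and even denominators: the even ones reproduce the `sinh` product at `x / 2`.
The quotient `sinh (2y) / sinh y = 2 cosh y` then gives the product for `cosh`. -/
lemma prod_range_two_mul_eq (x : ℝ) (n : ℕ) :
    ∏ j ∈ Finset.range (2 * n), (1 + x ^ 2 / ((j : ℝ) + 1) ^ 2) =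
      (∏ j ∈ Finset.range n, (1 + x ^ 2 / (2 * (j : ℝ) + 1) ^ 2)) *
        ∏ j ∈ Finset.range n, (1 + (x / 2) ^ 2 / ((j : ℝ) + 1) ^ 2) := by
  induction n with
  | zero => simp
  | succ n ih =>
    rw [show 2 * (n + 1) = 2 * n + 1 + 1 by ring, Finset.prod_range_succ, Finset.prod_range_succ,
      ih, Finset.prod_range_succ, Finset.prod_range_succ]
    have : x ^ 2 / (((2 * n + 1 : ℕ) : ℝ) + 1) ^ 2 = (x / 2) ^ 2 / ((n : ℝ) + 1) ^ 2 := by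
      push_cast
      field_simp
      ring
    rw [this]
    push_cast
    ring

lemma tendsto_euler_cosh_prod (x : ℝ) :
    Tendsto (fun n : ℕ => ∏ j ∈ Finset.range n, (1 + x ^ 2 / (2 * (j : ℝ) + 1) ^ 2)) atTop
      (𝓝 (Real.cosh (Real.pi * x / 2))) := by
  rcases eq_or_ne x 0 with rfl | hx
  · simp
  have h1 := (tendsto_euler_sinh_prod hx).comp
    (tendsto_id.const_mul_atTop' (show 0 < 2 by norm_num))
  have h2 := tendsto_euler_sinh_prod (x := x / 2) (by positivity)
  have hs : Real.sinh (Real.pi * (x / 2)) ≠ 0 := by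
    rw [Real.sinh_ne_zero]; have := Real.pi_ne_zero; positivity
  have hpi := Real.pi_ne_zero
  have h3 := h1.div h2 (by positivity)
  have e : Real.sinh (Real.pi * x) / (Real.pi * x) /
      (Real.sinh (Real.pi * (x / 2)) / (Real.pi * (x / 2))) = Real.cosh (Real.pi * x / 2) := by
    have := Real.sinh_two_mul (Real.pi * (x / 2))
    rw [show 2 * (Real.pi * (x / 2)) = Real.pi * x by ring] at this
    rw [this, mul_div_assoc Real.pi]
    field_simp
  rw [e] at h3
  refine h3.congr fun n => ?_
  simp only [Function.comp_apply, id, Pi.div_apply, prod_range_two_mul_eq]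
  rw [mul_div_assoc, div_self, mul_one]
  exact (Finset.prod_pos fun j _ => by positivity).ne'

lemma hasSum_inv_sinh {k : ℝ} (hk : 0 < k) :
    HasSum (fun n : ℕ => 2 * Real.exp (-(2 * n + 1) * k)) (1 / Real.sinh k) := by
  have hq : Real.exp (-2 * k) < 1 := Real.exp_lt_one_iff.2 (by linarith)
  have h := (hasSum_geometric_of_lt_one (Real.exp_pos _).le hq).mul_left (2 * Real.exp (-k))
  have hs : 0 < Real.sinh k := Real.sinh_pos_iff.2 hk
  have e : 2 * Real.exp (-k) * (1 - Real.exp (-2 * k))⁻¹ = 1 / Real.sinh k := by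
    have h1 : 1 - Real.exp (-2 * k) ≠ 0 := by linarith
    rw [eq_div_iff hs.ne', mul_assoc, mul_comm (_⁻¹), ← mul_assoc, ← div_eq_mul_inv,
      div_eq_one_iff_eq h1, Real.sinh_eq]
    have e1 : Real.exp (-k) * Real.exp k = 1 := by rw [← Real.exp_add]; simp
    have e2 : Real.exp (-2 * k) = Real.exp (-k) * Real.exp (-k) := by
      rw [← Real.exp_add]; ring_nf
    rw [e2]
    linear_combination e1
  rw [e] at h
  refine h.congr_fun fun n => ?_
  rw [← Real.exp_nat_mul, mul_assoc, ← Real.exp_add]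
  ring_nf

lemma hasSum_inv_sinh_sq {k : ℝ} (hk : 0 < k) :
    HasSum (fun n : ℕ => 4 * ((n : ℝ) + 1) * Real.exp (-(2 * ((n : ℝ) + 1)) * k))
      (1 / Real.sinh k ^ 2) := by
  have hq : Real.exp (-2 * k) < 1 := Real.exp_lt_one_iff.2 (by linarith)
  -- The series `∑ n qⁿ = q / (1 - q)²` with `q = exp (-2k)` is shifted by one index, its zeroth
  -- term being `0`.
  have h := (hasSum_nat_add_iff' 1).2 (hasSum_coe_mul_geometric_of_norm_lt_one
    (r := Real.exp (-2 * k)) (by rwa [Real.norm_of_nonneg (Real.exp_pos _).le]))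
  have h := h.mul_left 4
  have hs : 0 < Real.sinh k := Real.sinh_pos_iff.2 hk
  have e : 4 * (Real.exp (-2 * k) / (1 - Real.exp (-2 * k)) ^ 2 -
      ∑ i ∈ Finset.range 1, (i : ℝ) * Real.exp (-2 * k) ^ i) = 1 / Real.sinh k ^ 2 := by
    have h1 : 1 - Real.exp (-2 * k) ≠ 0 := by linarith
    have e1 : Real.exp (-k) * Real.exp k = 1 := by rw [← Real.exp_add]; simp
    have e2 : Real.exp (-2 * k) = Real.exp (-k) * Real.exp (-k) := by
      rw [← Real.exp_add]; ring_nf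
    have e3 : 2 * Real.exp (-k) * Real.sinh k = 1 - Real.exp (-2 * k) := by
      rw [Real.sinh_eq, e2]; linear_combination e1
    rw [← e3, e2]
    have := Real.exp_pos (-k)
    simp
    field_simp
    norm_num
  rw [e] at h
  refine h.congr_fun fun n => ?_
  rw [← Real.exp_nat_mul]
  push_cast
  ring_nf

/-- Expanding `1 / sinh k` in odd exponentials turns each term into a Frullani integral; the
logarithms sum to that of the Euler product. -/
lemma integral_one_sub_cos_div_sinh (x : ℝ) :
    ∫ k in Ioi (0 : ℝ), (1 / Real.sinh k) * ((1 - Real.cos (x * k)) / k) =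
      Real.log (Real.cosh (Real.pi * x / 2)) := by
  have hc : ∀ n : ℕ, (0 : ℝ) < 2 * n + 1 := fun n => by positivity
  refine setIntegral_eq_of_hasSum_of_nonneg measurableSet_Ioi
    (f := fun n k => 2 * (Real.exp (-(2 * n + 1) * k) * ((1 - Real.cos (x * k)) / k)))
    (fun n => (integrableOn_exp_mul_one_sub_cos (hc n) x).const_mul 2) (fun n k hk => ?_) ?_
    (fun k hk => ?_)
  · have hk : 0 < k := hk
    have : 0 ≤ 1 - Real.cos (x * k) := by linarith [Real.cos_le_one (x * k)]
    positivity
  · have h := ((Real.continuousAt_log (Real.cosh_pos (Real.pi * x / 2)).ne').tendsto).comp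
      (tendsto_euler_cosh_prod x)
    refine h.congr fun N => ?_
    simp only [Function.comp_apply]
    rw [Real.log_prod fun j _ => by positivity]
    refine Finset.sum_congr rfl fun n _ => ?_
    rw [integral_const_mul, integral_exp_mul_one_sub_cos (hc n)]
    ring
  · refine ((hasSum_inv_sinh hk).mul_right _).congr_fun fun n => ?_
    ring

lemma rePhaseInfty_sub (x : ℝ) :
    rePhaseInfty 0 - rePhaseInfty x = Real.log (Real.cosh (Real.pi * x / 2)) -
      Real.log (1 + x ^ 2) / 2 + Real.log (1 + x ^ 2 / 9) / 2 := by
  have hA := integrableOn_rePhase_zero_sub (t := 0) (x := x) le_rfl zero_le_one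
  have h1 := integrableOn_exp_mul_one_sub_cos one_pos x
  have h3 := integrableOn_exp_mul_one_sub_cos (by norm_num : (0 : ℝ) < 3) x
  rw [rePhaseInfty_eq, rePhaseInfty_eq, rePhase_zero_sub_eq_integral le_rfl zero_le_one]
  have hI1 := integral_exp_mul_one_sub_cos one_pos x
  have hI3 := integral_exp_mul_one_sub_cos (by norm_num : (0 : ℝ) < 3) x
  have hS := integral_one_sub_cos_div_sinh x
  have hA1 : IntegrableOn (fun k : ℝ =>
      halfWeight 0 k * ((1 - Real.cos (x * k)) / k) / (2 * Real.sinh k) +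
        Real.exp (-1 * k) * ((1 - Real.cos (x * k)) / k)) (Ioi 0) := hA.add h1
  rw [setIntegral_congr_fun (g := fun k =>
      halfWeight 0 k * ((1 - Real.cos (x * k)) / k) / (2 * Real.sinh k) +
        Real.exp (-1 * k) * ((1 - Real.cos (x * k)) / k) -
        Real.exp (-3 * k) * ((1 - Real.cos (x * k)) / k)) measurableSet_Ioi,
    integral_sub hA1 h3, integral_add hA h1, hI1, hI3] at hS
  · norm_num at hS ⊢
    linarith
  · intro k hk
    have hs : 0 < Real.sinh k := Real.sinh_pos_iff.2 hk
    -- Only at `t = 0` is this identity used: it reduces the weight to one hyperbolic term and two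
    -- exponentials, whose integrals are all explicit.
    have e : halfWeight 0 k / (2 * Real.sinh k) =
        1 / Real.sinh k - Real.exp (-1 * k) + Real.exp (-3 * k) := by
      rw [div_eq_iff (by positivity)]
      unfold halfWeight
      have e1 : Real.exp (-1 * k) * Real.exp k = 1 := by rw [← Real.exp_add]; simp
      have e2 : Real.exp (-(2 - 0) * k) = Real.exp (-1 * k) ^ 2 := by
        rw [← Real.exp_nat_mul]; push_cast; ring_nf
      have e3 : Real.exp (-3 * k) = Real.exp (-1 * k) ^ 3 := by
        rw [← Real.exp_nat_mul]; push_cast; ring_nf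
      have e4 : Real.exp (-(4 - 0) * k) = Real.exp (-1 * k) ^ 4 := by
        rw [← Real.exp_nat_mul]; push_cast; ring_nf
      have e5 : (1 / Real.sinh k - Real.exp (-1 * k) + Real.exp (-3 * k)) * (2 * Real.sinh k) =
          2 + (-Real.exp (-1 * k) + Real.exp (-3 * k)) * (2 * Real.sinh k) := by
        field_simp
        ring
      rw [e5, e2, e3, e4, Real.sinh_eq, show -k = -1 * k by ring, neg_zero, zero_mul,
        Real.exp_zero]
      linear_combination (1 - Real.exp (-1 * k) ^ 2) * e1
    have e' : halfWeight 0 k * ((1 - Real.cos (x * k)) / k) / (2 * Real.sinh k) =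
        halfWeight 0 k / (2 * Real.sinh k) * ((1 - Real.cos (x * k)) / k) := by ring
    simp only
    rw [e', e]
    ring

/-! ### The value of the limit phase at `x = 0`, by Stirling's formula. -/

lemma sum_range_log_eq (N : ℕ) :
    ∑ n ∈ Finset.range N, (2 * ((n : ℝ) + 1) *
      (Real.log (2 * ((n : ℝ) + 1) + 1) - Real.log (2 * ((n : ℝ) + 1) - 1)) - 2) =
    2 * N * Real.log (2 * N + 1) - 2 * Real.log ((2 * N).factorial) + 2 * N * Real.log 2 +
      2 * Real.log (N.factorial) - 2 * N := by
  induction N with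
  | zero => simp
  | succ N ih =>
    rw [Finset.sum_range_succ, ih, show 2 * (N + 1) = 2 * N + 1 + 1 by ring, Nat.factorial_succ,
      Nat.factorial_succ, Nat.factorial_succ]
    push_cast
    have hf : ((2 * N).factorial : ℝ) ≠ 0 := by exact_mod_cast (2 * N).factorial_ne_zero
    have hf' : (N.factorial : ℝ) ≠ 0 := by exact_mod_cast N.factorial_ne_zero
    rw [show (2 * (N : ℝ) + 1 + 1) = 2 * (N + 1) by ring,
      Real.log_mul (by positivity) (by positivity), Real.log_mul (by positivity) (by positivity),
      Real.log_mul (by positivity) (by positivity), Real.log_mul (by positivity) (by positivity),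
      show 2 * ((N : ℝ) + 1) - 1 = 2 * N + 1 by ring]
    ring

lemma tendsto_sum_range_log :
    Tendsto (fun N : ℕ => ∑ n ∈ Finset.range N, (2 * ((n : ℝ) + 1) *
      (Real.log (2 * ((n : ℝ) + 1) + 1) - Real.log (2 * ((n : ℝ) + 1) - 1)) - 2)) atTop
      (𝓝 (1 - Real.log 2)) := by
  have htwo : Tendsto (fun N : ℕ => 2 * N) atTop atTop :=
    tendsto_id.const_mul_atTop' (show 0 < 2 by norm_num)
  have hS : Tendsto (fun N => Real.log (Stirling.stirlingSeq N)) atTop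
      (𝓝 (Real.log (√Real.pi))) :=
    (Real.continuousAt_log (by have := Real.pi_pos; positivity)).tendsto.comp
      Stirling.tendsto_stirlingSeq_sqrt_pi
  have hS2 := hS.comp htwo
  have hL : Tendsto (fun N : ℕ => ((2 * N : ℕ) : ℝ) * Real.log (1 + 1 / ((2 * N : ℕ) : ℝ))) atTop
      (𝓝 1) :=
    (Real.tendsto_mul_log_one_add_div_atTop 1).comp
      (tendsto_natCast_atTop_atTop.comp htwo)
  -- The factorials enter through `2 (log S_N - log S_{2N})`, with `S` the Stirling sequence. This
  -- tends to `0`, so only `2N log (1 + 1 / (2N)) → 1` and `-log 2` remain.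
  have h := (hL.add ((hS.sub hS2).const_mul 2)).sub_const (Real.log 2)
  simp only [sub_self, mul_zero, add_zero] at h
  refine h.congr' ?_
  filter_upwards [eventually_gt_atTop 0] with N hN
  have hN' : (0 : ℝ) < N := by exact_mod_cast hN
  rw [sum_range_log_eq]
  simp only [Function.comp_apply]
  rw [Stirling.log_stirlingSeq_formula, Stirling.log_stirlingSeq_formula]
  push_cast
  rw [show 1 + 1 / (2 * (N : ℝ)) = (2 * N + 1) / (2 * N) by field_simp,
    Real.log_div (by positivity) (by positivity), Real.log_div (by positivity) (by positivity),
    Real.log_div (by positivity) (by positivity), Real.log_exp,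
    Real.log_mul two_ne_zero (by positivity : (2 * (N : ℝ)) ≠ 0),
    Real.log_mul two_ne_zero hN'.ne']
  ring

lemma integral_sinh_sub_div :
    ∫ k in Ioi (0 : ℝ), 1 / Real.sinh k ^ 2 * (Real.sinh k / k - 1) = 1 - Real.log 2 := by
  have hm : ∀ n : ℕ, (1 : ℝ) < 2 * ((n : ℝ) + 1) := fun n => by
    have : (0 : ℝ) ≤ n := n.cast_nonneg
    linarith
  refine setIntegral_eq_of_hasSum_of_nonneg measurableSet_Ioi
    (f := fun n k => 4 * ((n : ℝ) + 1) *
      (Real.exp (-(2 * ((n : ℝ) + 1)) * k) * (Real.sinh k / k - 1)))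
    (fun n => (integrableOn_exp_mul_sinh_div (hm n)).const_mul _) (fun n k hk => ?_) ?_
    (fun k hk => ?_)
  · have hk : 0 < k := hk
    have : 0 ≤ Real.sinh k / k - 1 := by
      rw [sub_nonneg, one_le_div hk]
      exact Real.self_le_sinh_iff.2 hk.le
    positivity
  · refine tendsto_sum_range_log.congr fun N => Finset.sum_congr rfl fun n _ => ?_
    rw [integral_const_mul, integral_exp_mul_sinh_div (hm n)]
    field_simp
    ring
  · refine ((hasSum_inv_sinh_sq hk).mul_right _).congr_fun fun n => ?_
    ring

lemma rePhaseInfty_zero : rePhaseInfty 0 = 2 - Real.log 6 := by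
  have hA := integrableOn_rePhaseInftyIntegrand 0
  have h2 := (integrableOn_exp_mul_sinh_div (by norm_num : (1 : ℝ) < 2)).const_mul 2
  have hI2 := integral_exp_mul_sinh_div (by norm_num : (1 : ℝ) < 2)
  have hS := integral_sinh_sub_div
  rw [setIntegral_congr_fun (g := fun k => rePhaseInftyIntegrand 0 k +
      2 * (Real.exp (-2 * k) * (Real.sinh k / k - 1))) measurableSet_Ioi,
    integral_add hA h2, integral_const_mul, hI2] at hS
  · have h6 : Real.log 6 = Real.log 2 + Real.log 3 := by
      rw [← Real.log_mul (by norm_num) (by norm_num)]; norm_num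
    norm_num at hS
    unfold rePhaseInfty
    linarith
  · intro k hk
    have hk : 0 < k := hk
    have hs : 0 < Real.sinh k := Real.sinh_pos_iff.2 hk
    unfold rePhaseInftyIntegrand
    simp only [zero_mul, Real.cos_zero, one_mul]
    have e1 : Real.exp (-k) * Real.exp k = 1 := by rw [← Real.exp_add]; simp
    have e2 : Real.exp (-2 * k) = Real.exp (-k) ^ 2 := by
      rw [← Real.exp_nat_mul]; push_cast; ring_nf
    have e4 : Real.exp (-4 * k) = Real.exp (-k) ^ 4 := by
      rw [← Real.exp_nat_mul]; push_cast; ring_nf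
    -- This splits the integrand into `(1 / sinh² k - 2 exp (-2k)) * (sinh k / k - 1)`, both parts
    -- of which have known integrals.
    have e : 2 * Real.exp (-2 * k) - Real.exp (-4 * k) + 1 =
        2 - 4 * Real.exp (-2 * k) * Real.sinh k ^ 2 := by
      rw [e2, e4, Real.sinh_eq]
      linear_combination (Real.exp (-k) * Real.exp k + 1 - 2 * Real.exp (-k) ^ 2) * e1
    rw [e, cosh_two_mul_sub_one]
    field_simp
    ring

/-- The closed form of the limit integrand. -/
lemma limitIntegrand_eq (x : ℝ) :
    limitIntegrand x = Real.exp 4 / 4 * (1 / Real.cosh (Real.pi * x / 2) ^ 2) := by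
  have h := rePhaseInfty_sub x
  rw [rePhaseInfty_zero] at h
  have e : 2 * rePhaseInfty x = 4 - 2 * Real.log 6 - 2 * Real.log (Real.cosh (Real.pi * x / 2)) +
      Real.log (1 + x ^ 2) - Real.log (1 + x ^ 2 / 9) := by linarith
  have hc := Real.cosh_pos (Real.pi * x / 2)
  unfold limitIntegrand
  rw [e, Real.exp_sub, Real.exp_add, Real.exp_sub, Real.exp_sub, two_mul (Real.log _),
    two_mul (Real.log _), Real.exp_add, Real.exp_add, Real.exp_log (by norm_num),
    Real.exp_log hc, Real.exp_log (by positivity), Real.exp_log (by positivity)]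
  field_simp
  ring

/-! ### The limit value in closed form and its decimals. -/

lemma hasDerivAt_sech_sq_primitive (x : ℝ) :
    HasDerivAt (fun x => -(4 / Real.pi) / (Real.exp (Real.pi * x) + 1))
      (1 / Real.cosh (Real.pi * x / 2) ^ 2) x := by
  have h1 : HasDerivAt (fun x => Real.exp (Real.pi * x) + 1)
      (Real.exp (Real.pi * x) * (Real.pi * 1)) x :=
    (((hasDerivAt_id x).const_mul Real.pi).exp).add_const 1
  have hpos := Real.exp_pos (Real.pi * x)
  have h2 : HasDerivAt (fun x => -(4 / Real.pi) / (Real.exp (Real.pi * x) + 1)) _ x :=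
    (hasDerivAt_const x (-(4 / Real.pi))).div h1 (by positivity)
  refine h2.congr_deriv ?_
  have hc := Real.cosh_pos (Real.pi * x / 2)
  have hpi := Real.pi_ne_zero
  have e' : Real.exp (Real.pi * x) = Real.exp (Real.pi * x / 2) ^ 2 := by
    rw [← Real.exp_nat_mul]; push_cast; ring_nf
  have e : Real.exp (Real.pi * x) + 1 =
      2 * Real.exp (Real.pi * x / 2) * Real.cosh (Real.pi * x / 2) := by
    rw [e', Real.cosh_eq, Real.exp_neg]
    field_simp
  rw [e, e']
  field_simp
  ring

lemma integrable_limitIntegrand : Integrable limitIntegrand := by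
  refine (integrable_lineNormSq le_rfl zero_lt_one).congr (Eventually.of_forall fun x => ?_)
  simp only [blaschkeSq, limitIntegrand, rePhaseInfty_eq]
  norm_num

lemma lineNormSq_zero : lineNormSq 0 = ∫ x, limitIntegrand x := by
  unfold lineNormSq
  congr 1; ext x
  simp only [blaschkeSq, limitIntegrand, rePhaseInfty_eq]
  norm_num

lemma integral_limitIntegrand : ∫ x, limitIntegrand x = Real.exp 4 / Real.pi := by
  have hi : Integrable fun x : ℝ => 1 / Real.cosh (Real.pi * x / 2) ^ 2 := by
    refine (integrable_limitIntegrand.const_mul (4 / Real.exp 4)).congr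
      (Eventually.of_forall fun x => ?_)
    simp only [limitIntegrand_eq]
    have := Real.cosh_pos (Real.pi * x / 2)
    field_simp
  have hpi := Real.pi_pos
  have htop : Tendsto (fun x => -(4 / Real.pi) / (Real.exp (Real.pi * x) + 1)) atTop (𝓝 0) := by
    refine Tendsto.const_div_atTop (tendsto_atTop_add_const_right _ _ ?_) _
    exact Real.tendsto_exp_atTop.comp (tendsto_id.const_mul_atTop hpi)
  have hbot : Tendsto (fun x => -(4 / Real.pi) / (Real.exp (Real.pi * x) + 1)) atBot
      (𝓝 (-(4 / Real.pi))) := by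
    have h1 : Tendsto (fun x => Real.exp (Real.pi * x) + 1) atBot (𝓝 (0 + 1)) :=
      (Real.tendsto_exp_atBot.comp (tendsto_id.const_mul_atBot hpi)).add_const 1
    have h2 := (tendsto_const_nhds (x := -(4 / Real.pi))).div h1 (by norm_num)
    rw [zero_add, div_one] at h2
    exact h2
  have h := integral_of_hasDerivAt_of_tendsto hasDerivAt_sech_sq_primitive hi hbot htop
  simp_rw [limitIntegrand_eq]
  rw [integral_const_mul, h]
  field_simp
  ring

lemma limitValue_eq : limitValue = 4 * Real.pi ^ 2 / Real.exp 2 := by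
  unfold limitValue
  rw [integral_limitIntegrand, show (4 : ℝ) = 2 + 2 by norm_num, Real.exp_add]
  have := Real.pi_pos
  field_simp

lemma abs_limitValue_sub_lt : |limitValue - 5.342823| < 5 / 10 ^ 7 := by
  have e : Real.exp 2 = Real.exp 1 ^ 2 := by rw [← Real.exp_nat_mul]; norm_num
  have h1 := Real.pi_gt_d20
  have h2 := Real.pi_lt_d20
  have h3 := Real.exp_one_gt_d9
  have h4 := Real.exp_one_lt_d9
  rw [limitValue_eq, e, abs_lt, lt_sub_iff_add_lt, sub_lt_iff_lt_add,
    lt_div_iff₀ (by positivity), div_lt_iff₀ (by positivity)]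
  have p1 : (3.141592653 : ℝ) ^ 2 ≤ Real.pi ^ 2 := by gcongr; linarith
  have p2 : Real.pi ^ 2 ≤ (3.141592654 : ℝ) ^ 2 := by gcongr; linarith
  have q1 : (2.7182818283 : ℝ) ^ 2 ≤ Real.exp 1 ^ 2 := by gcongr
  have q2 : Real.exp 1 ^ 2 ≤ (2.7182818286 : ℝ) ^ 2 := by gcongr
  norm_num at p1 p2 q1 q2 ⊢
  constructor <;> linarith

/-! ### The two limits -/

lemma tendsto_rePhase {ι : Type*} {l : Filter ι} {t x s : ι → ℝ} {t₀ x₀ s₀ : ℝ}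
    (ht : Tendsto t l (𝓝 t₀)) (hx : Tendsto x l (𝓝 x₀)) (hs : Tendsto s l (𝓝 s₀))
    (ht' : ∀ᶠ i in l, t i ∈ Icc (0 : ℝ) 1) (hs' : ∀ᶠ i in l, |s i| ≤ 1)
    (ht₀ : t₀ ∈ Icc (0 : ℝ) 1) (hs₀ : |s₀| ≤ 1) :
    Tendsto (fun i => rePhase (t i) (x i - Complex.I * s i)) l
      (𝓝 (rePhase t₀ (x₀ - Complex.I * s₀))) := by
  have hc : Tendsto (fun p : ℝ × ℂ => rePhase p.1 p.2)
      (𝓝[Icc 0 1 ×ˢ {z | |z.im| ≤ 1}] (t₀, (x₀ - Complex.I * s₀ : ℂ)))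
      (𝓝 (rePhase t₀ (x₀ - Complex.I * s₀))) :=
    (continuousOn_rePhase (t₀, (x₀ - Complex.I * s₀ : ℂ)) ⟨ht₀, by simpa using hs₀⟩).tendsto
  have hz : Tendsto (fun i => (x i - Complex.I * s i : ℂ)) l (𝓝 (x₀ - Complex.I * s₀)) :=
    ((Complex.continuous_ofReal.tendsto _).comp hx).sub
      (((Complex.continuous_ofReal.tendsto _).comp hs).const_mul Complex.I)
  have : Tendsto (fun i => ((t i, (x i - Complex.I * s i : ℂ)) : ℝ × ℂ)) l
      (𝓝[Icc 0 1 ×ˢ {z | |z.im| ≤ 1}] (t₀, (x₀ - Complex.I * s₀ : ℂ))) := by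
    refine tendsto_nhdsWithin_iff.2 ⟨ht.prodMk_nhds hz, ?_⟩
    filter_upwards [ht', hs'] with i hi hi'
    exact ⟨hi, by simpa using hi'⟩
  have h := hc.comp this
  rw [Function.comp_def] at h
  exact h

lemma tendsto_lineNormSq_zero : Tendsto lineNormSq (𝓝[>] 0) (𝓝 (lineNormSq 0)) := by
  -- Staying below `1 / 2` keeps the Blaschke factor uniformly bounded: `9 / (1 - t) ^ 2 ≤ 36`.
  have hlt : ∀ᶠ t : ℝ in 𝓝[>] 0, 0 < t ∧ t < 1 / 2 := Ioo_mem_nhdsGT (by norm_num)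
  have hid : Tendsto (fun t : ℝ => t) (𝓝[>] 0) (𝓝 0) := tendsto_id.mono_left nhdsWithin_le_nhds
  refine tendsto_integral_filter_of_dominated_convergence
    (fun x => 36 * (4 * Real.exp 192) * (1 + x ^ 2)⁻¹) ?_ ?_
    (integrable_inv_one_add_sq.const_mul _) ?_
  · filter_upwards [hlt] with t ht
    exact (continuous_lineNormSq_integrand ht.1.le (by linarith [ht.2])).aestronglyMeasurable
  · filter_upwards [hlt] with t ht
    refine Eventually.of_forall fun x => ?_
    rw [Real.norm_of_nonneg (mul_nonneg (blaschkeSq_nonneg _ _ _) (Real.exp_pos _).le)]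
    refine (lineNormSq_integrand_le ht.1.le (by linarith [ht.2]) x).trans ?_
    have h : 9 / (1 - t) ^ 2 ≤ 36 := by
      have : 1 / 2 ≤ 1 - t := by linarith [ht.2]
      rw [div_le_iff₀ (by positivity)]
      nlinarith
    gcongr
  · refine Eventually.of_forall fun x => Tendsto.mul ?_ ?_
    · have : ContinuousAt (fun t => blaschkeSq t 1 x) 0 := by
        unfold blaschkeSq
        refine ContinuousAt.div (by fun_prop) (by fun_prop) ?_
        norm_num
        positivity
      exact this.tendsto.mono_left nhdsWithin_le_nhds
    · refine (Real.continuous_exp.tendsto _).comp (Tendsto.const_mul 2 ?_)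
      refine tendsto_rePhase hid tendsto_const_nhds tendsto_const_nhds ?_
        (Eventually.of_forall fun _ => by simp) ⟨le_rfl, zero_le_one⟩ (by simp)
      filter_upwards [hlt] with t ht
      exact ⟨ht.1.le, by linarith [ht.2]⟩

/-- As `t → 1` the squared Blaschke factor concentrates at `x = 0` on the scale `1 - t`. The
substitution `x = (1 - t) u` turns it into the fixed kernel `(1 + u ^ 2)⁻¹` times a factor with a
pointwise limit. -/
lemma one_sub_mul_lineNormSq {t : ℝ} (ht1 : t < 1) :
    (1 - t) * lineNormSq t = ∫ u : ℝ, (((1 - t) * u) ^ 2 + (3 - t) ^ 2) *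
      Real.exp (2 * rePhase t (((1 - t) * u : ℝ) - Complex.I * (1 : ℝ))) * (1 + u ^ 2)⁻¹ := by
  have hd : 0 < 1 - t := by linarith
  have h := Measure.integral_comp_mul_left
    (fun x => blaschkeSq t 1 x * Real.exp (2 * rePhase t (x - Complex.I * (1 : ℝ)))) (1 - t)
  rw [abs_of_pos (inv_pos.2 hd), smul_eq_mul, inv_mul_eq_div, eq_div_iff hd.ne'] at h
  unfold lineNormSq
  rw [← h, ← mul_comm (1 - t), ← integral_const_mul, ← integral_const_mul]
  congr 1; ext u
  have e : (2 - t - 1) = 1 - t := by ring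
  have e2 : (2 - t + 1) = 3 - t := by ring
  unfold blaschkeSq
  rw [e, e2, mul_pow, show (1 - t) ^ 2 * u ^ 2 + (1 - t) ^ 2 = (1 - t) ^ 2 * (1 + u ^ 2) by ring]
  field_simp

lemma tendsto_one_sub_mul_lineNormSq :
    Tendsto (fun t => (1 - t) * lineNormSq t) (𝓝[<] 1)
      (𝓝 (4 * Real.pi * Real.exp (2 * rePhase 1 ((0 : ℝ) - Complex.I * (1 : ℝ))))) := by
  have hlt : ∀ᶠ t : ℝ in 𝓝[<] 1, 0 < t ∧ t < 1 := Ioo_mem_nhdsLT (by norm_num)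
  have hid : Tendsto (fun t : ℝ => t) (𝓝[<] 1) (𝓝 1) := tendsto_id.mono_left nhdsWithin_le_nhds
  have hsub : Tendsto (fun t : ℝ => 1 - t) (𝓝[<] 1) (𝓝 0) := by
    simpa using hid.const_sub 1
  have hlim : 4 * Real.pi * Real.exp (2 * rePhase 1 ((0 : ℝ) - Complex.I * (1 : ℝ))) =
      ∫ u : ℝ, 4 * Real.exp (2 * rePhase 1 ((0 : ℝ) - Complex.I * (1 : ℝ))) * (1 + u ^ 2)⁻¹ := by
    rw [integral_const_mul, integral_univ_inv_one_add_sq]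
    ring
  rw [hlim]
  refine Tendsto.congr' (f₁ := fun t => ∫ u : ℝ, (((1 - t) * u) ^ 2 + (3 - t) ^ 2) *
      Real.exp (2 * rePhase t (((1 - t) * u : ℝ) - Complex.I * (1 : ℝ))) * (1 + u ^ 2)⁻¹) ?_ ?_
  · filter_upwards [hlt] with t ht
    exact (one_sub_mul_lineNormSq ht.2).symm
  refine tendsto_integral_filter_of_dominated_convergence
    (fun u => 9 * Real.exp 192 * (1 + u ^ 2)⁻¹) ?_ ?_ (integrable_inv_one_add_sq.const_mul _) ?_
  · filter_upwards [hlt] with t ht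
    have hc : Continuous fun u : ℝ => rePhase t (((1 - t) * u : ℝ) - Complex.I * (1 : ℝ)) :=
      (continuous_rePhase ht.1.le ht.2.le (by simp)).comp (continuous_const.mul continuous_id)
    have hd : Continuous fun u : ℝ => (1 + u ^ 2)⁻¹ :=
      Continuous.inv₀ (by fun_prop) fun u => by positivity
    exact (((by fun_prop : Continuous fun u : ℝ => ((1 - t) * u) ^ 2 + (3 - t) ^ 2).mul
      (Real.continuous_exp.comp (hc.const_mul 2))).mul hd).aestronglyMeasurable
  · filter_upwards [hlt] with t ht
    refine Eventually.of_forall fun u => ?_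
    rw [Real.norm_of_nonneg (by positivity)]
    have h1 := exp_two_mul_rePhase_le (x := (1 - t) * u) ht.1.le ht.2.le
    -- The quadratic growth of the rescaled numerator is absorbed by the decay of the phase factor,
    -- uniformly in `t`.
    have h2 : ((1 - t) * u) ^ 2 + (3 - t) ^ 2 ≤ 9 * (1 + ((1 - t) * u) ^ 2 / 4) ^ 2 := by
      nlinarith [sq_nonneg ((1 - t) * u), sq_nonneg (((1 - t) * u) ^ 2), ht.1, ht.2]
    have h3 : (((1 - t) * u) ^ 2 + (3 - t) ^ 2) *
        Real.exp (2 * rePhase t (((1 - t) * u : ℝ) - Complex.I * (1 : ℝ))) ≤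
        9 * Real.exp 192 := by
      calc _ ≤ 9 * (1 + ((1 - t) * u) ^ 2 / 4) ^ 2 *
            (Real.exp 192 / (1 + ((1 - t) * u) ^ 2 / 4) ^ 2) :=
            mul_le_mul h2 h1 (Real.exp_pos _).le (by positivity)
        _ = _ := by
            have : 1 + ((1 - t) * u) ^ 2 / 4 ≠ 0 := by positivity
            field_simp
    gcongr
  · refine Eventually.of_forall fun u => Tendsto.mul_const _ (Tendsto.mul ?_ ?_)
    · have : Continuous fun t : ℝ => ((1 - t) * u) ^ 2 + (3 - t) ^ 2 := by fun_prop
      have h := (this.tendsto 1).mono_left (nhdsWithin_le_nhds (s := Iio 1))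
      norm_num at h
      exact h
    · refine (Real.continuous_exp.tendsto _).comp (Tendsto.const_mul 2 ?_)
      refine tendsto_rePhase hid ?_ tendsto_const_nhds ?_
        (Eventually.of_forall fun _ => by simp) ⟨zero_le_one, le_rfl⟩ (by simp)
      · simpa using hsub.mul_const u
      · filter_upwards [hlt] with t ht
        exact ⟨ht.1.le, ht.2.le⟩

lemma tendsto_threeLinesRatio_atTop :
    Tendsto (fun γ : ℝ => 4 * Real.pi * threeLinesRatio γ (optimizer γ)) atTop
      (𝓝 limitValue) := by
  have ht : Tendsto (fun γ : ℝ => 2 / γ) atTop (𝓝[>] 0) := by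
    refine tendsto_nhdsWithin_iff.2 ⟨tendsto_const_nhds.div_atTop tendsto_id, ?_⟩
    filter_upwards [eventually_gt_atTop 0] with γ hγ
    exact div_pos two_pos hγ
  have hN := tendsto_lineNormSq_zero.comp ht
  have hpow : Tendsto (fun γ : ℝ => ((1 - 2 / γ) ^ γ)⁻¹) atTop (𝓝 (Real.exp 2)) := by
    have h := (Real.tendsto_one_add_div_rpow_exp (-2)).inv₀ (Real.exp_pos _).ne'
    rw [Real.exp_neg, inv_inv] at h
    refine h.congr fun γ => ?_
    rw [neg_div, ← sub_eq_add_neg]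
  have hphase : Tendsto (fun γ : ℝ =>
      rePhase (2 / γ) ((0 : ℝ) - Complex.I * ((2 / γ : ℝ) : ℂ)) * γ) atTop (𝓝 0) := by
    -- The cubic bound on the phase gives `96 * (2 / γ) ^ 3 * γ = 768 / γ ^ 2`.
    have h0 : Tendsto (fun γ : ℝ => 768 / γ ^ 2) atTop (𝓝 0) :=
      tendsto_const_nhds.div_atTop (tendsto_pow_atTop two_ne_zero)
    refine squeeze_zero_norm' ?_ h0
    filter_upwards [eventually_gt_atTop 2] with γ hγ
    obtain ⟨ht0, ht1⟩ := two_div_mem hγ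
    have hγ0 : 0 < γ := by linarith
    have h := abs_rePhase_le (z := (0 : ℝ) - Complex.I * ((2 / γ : ℝ) : ℂ)) ht0.le ht1.le
      (by simpa [abs_div, abs_of_pos hγ0] using ht1.le)
    have e : ‖((0 : ℝ) - Complex.I * ((2 / γ : ℝ) : ℂ) : ℂ)‖ = 2 / γ := by
      rw [Complex.ofReal_zero, zero_sub, norm_neg, norm_mul, Complex.norm_I, one_mul,
        Complex.norm_real, Real.norm_of_nonneg ht0.le]
    rw [e] at h
    rw [norm_mul, Real.norm_eq_abs, Real.norm_of_nonneg hγ0.le]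
    calc _ ≤ 96 * (2 / γ) ^ 3 * γ := by gcongr
      _ = _ := by field_simp; norm_num
  have hexp := (Real.continuous_exp.tendsto 0).comp hphase
  rw [Real.exp_zero] at hexp
  have hne : lineNormSq 0 ≠ 0 := by
    rw [lineNormSq_zero, integral_limitIntegrand]
    have := Real.pi_pos
    positivity
  have h := ((hpow.mul hexp).div hN hne).const_mul (4 * Real.pi)
  have e : 4 * Real.pi * (Real.exp 2 * 1 / lineNormSq 0) = limitValue := by
    unfold limitValue
    rw [lineNormSq_zero]
    ring
  rw [e] at h
  refine h.congr' ?_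
  filter_upwards [eventually_gt_atTop 2] with γ hγ
  obtain ⟨ht0, ht1⟩ := two_div_mem hγ
  have hd : 0 < 1 - 2 / γ := by linarith
  rw [threeLinesRatio_eq hγ, Real.mul_rpow (inv_pos.2 hd).le (Real.exp_pos _).le,
    Real.inv_rpow hd.le, ← Real.exp_mul]
  rfl

lemma tendsto_threeLinesRatio_two :
    Tendsto (fun γ : ℝ => 4 * Real.pi * (γ - 2) ^ (γ / 2) / γ ^ (γ / 2) *
        threeLinesRatio γ (optimizer γ)) (𝓝[>] (2 : ℝ)) (𝓝 1) := by
  have hid : Tendsto (fun γ : ℝ => γ) (𝓝[>] 2) (𝓝 2) := tendsto_id.mono_left nhdsWithin_le_nhds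
  have ht1 : Tendsto (fun γ : ℝ => 2 / γ) (𝓝[>] 2) (𝓝 1) := by
    have := (tendsto_const_nhds (x := (2 : ℝ))).div hid two_ne_zero
    rwa [div_self two_ne_zero] at this
  have ht : Tendsto (fun γ : ℝ => 2 / γ) (𝓝[>] 2) (𝓝[<] 1) := by
    refine tendsto_nhdsWithin_iff.2 ⟨ht1, ?_⟩
    filter_upwards [self_mem_nhdsWithin] with γ hγ
    exact (two_div_mem hγ).2
  have hN := tendsto_one_sub_mul_lineNormSq.comp ht
  have hδ : Tendsto (fun γ : ℝ => 1 - 2 / γ) (𝓝[>] 2) (𝓝[>] 0) := by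
    refine tendsto_nhdsWithin_iff.2 ⟨by simpa using ht1.const_sub 1, ?_⟩
    filter_upwards [self_mem_nhdsWithin] with γ hγ
    exact sub_pos.2 (two_div_mem hγ).2
  -- With `d = 1 - 2 / γ`, the surviving power is `d ^ (1 - γ / 2)`. Its exponent `1 - γ / 2 = -(γ /
  -- 2) d` vanishes with `d`, so the power tends to `1` because `d log d → 0`.
  have hlog : Tendsto (fun γ : ℝ =>
      Real.log (1 - 2 / γ) * (1 - 2 / γ) * (-(γ / 2))) (𝓝[>] 2) (𝓝 0) := by
    have hlm : Tendsto (fun x : ℝ => Real.log x * x) (𝓝[>] 0) (𝓝 0) := by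
      simpa using tendsto_log_mul_rpow_nhdsGT_zero one_pos
    have := (hlm.comp hδ).mul (hid.div_const 2).neg
    rw [zero_mul] at this
    exact this
  have hpow := (Real.continuous_exp.tendsto 0).comp hlog
  rw [Real.exp_zero] at hpow
  have hphase : Tendsto (fun γ : ℝ =>
      rePhase (2 / γ) ((0 : ℝ) - Complex.I * ((2 / γ : ℝ) : ℂ)) * γ) (𝓝[>] 2)
      (𝓝 (rePhase 1 ((0 : ℝ) - Complex.I * (1 : ℝ)) * 2)) := by
    refine Tendsto.mul ?_ hid
    refine tendsto_rePhase ht1 tendsto_const_nhds ht1 ?_ ?_ ⟨zero_le_one, le_rfl⟩ (by simp)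
    · filter_upwards [self_mem_nhdsWithin] with γ hγ
      exact ⟨(two_div_mem hγ).1.le, (two_div_mem hγ).2.le⟩
    · filter_upwards [self_mem_nhdsWithin] with γ hγ
      rw [abs_of_pos (two_div_mem hγ).1]
      exact (two_div_mem hγ).2.le
  have hexp := (Real.continuous_exp.tendsto _).comp hphase
  have hpi := Real.pi_pos
  have h := ((hpow.mul hexp).div hN (by positivity)).const_mul (4 * Real.pi)
  have e : 4 * Real.pi * (1 * Real.exp (rePhase 1 ((0 : ℝ) - Complex.I * (1 : ℝ)) * 2) /
      (4 * Real.pi * Real.exp (2 * rePhase 1 ((0 : ℝ) - Complex.I * (1 : ℝ))))) = 1 := by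
    rw [mul_comm _ (2 : ℝ)]
    field_simp
  rw [e] at h
  refine h.congr' ?_
  filter_upwards [self_mem_nhdsWithin] with γ hγ
  have hγ : 2 < γ := hγ
  have hd : 0 < 1 - 2 / γ := sub_pos.2 (two_div_mem hγ).2
  have e1 : (γ - 2) ^ (γ / 2) / γ ^ (γ / 2) = (1 - 2 / γ) ^ (γ / 2) := by
    rw [← Real.div_rpow (by linarith) (by linarith), sub_div, div_self (by linarith)]
  -- The three powers of `1 - 2 / γ` come from the rescaled `L²` norm, the prefactor and the sup
  -- norm.
  have e2 : Real.exp (Real.log (1 - 2 / γ) * (1 - 2 / γ) * (-(γ / 2))) =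
      (1 - 2 / γ) * (1 - 2 / γ) ^ (γ / 2) * ((1 - 2 / γ) ^ γ)⁻¹ := by
    rw [← Real.rpow_neg hd.le, ← Real.rpow_one_add' hd.le (by linarith), ← Real.rpow_add hd,
      Real.rpow_def_of_pos hd]
    congr 1
    field_simp
    ring
  rw [threeLinesRatio_eq hγ, Real.mul_rpow (inv_pos.2 hd).le (Real.exp_pos _).le,
    Real.inv_rpow hd.le, ← Real.exp_mul, mul_div_assoc (4 * Real.pi), e1]
  simp only [Function.comp_apply, Pi.div_apply]
  rw [e2]
  generalize 1 - 2 / γ = d at hd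
  field_simp

end ThreeLines

end

theorem lemma5p1 :
    -- the principal value defining the phase exists on the closed lower strip, the restrictions
    -- of the optimizer to `Im z = 0` and `Im z = -1` are its boundary values, and the three
    -- norms in the ratio are finite
    (∀ γ : ℝ, 2 < γ →
      (∀ z : ℂ, -1 ≤ z.im → z.im ≤ 0 →
        (∀ ε : ℝ, 0 < ε →
          IntegrableOn (ThreeLines.phaseIntegrand γ z) {k : ℝ | ε ≤ |k|} volume) ∧
        Tendsto (ThreeLines.truncatedPhase γ z) (𝓝[>] (0 : ℝ)) (𝓝 (ThreeLines.phase γ z))) ∧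
      ThreeLines.IsBoundaryValue (ThreeLines.optimizer γ) 0
        (ThreeLines.onLine (ThreeLines.optimizer γ) 0) ∧
      ThreeLines.IsBoundaryValue (ThreeLines.optimizer γ) (-1)
        (ThreeLines.onLine (ThreeLines.optimizer γ) (-1)) ∧
      MemLp (ThreeLines.onLine (ThreeLines.optimizer γ) (-(2 / γ))) ∞ volume ∧
      MemLp (ThreeLines.onLine (ThreeLines.optimizer γ) 0) ∞ volume ∧
      MemLp (ThreeLines.onLine (ThreeLines.optimizer γ) (-1)) 2 volume) ∧
    -- the limit `γ ↓ 2`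
    Tendsto (fun γ : ℝ => 4 * Real.pi * (γ - 2) ^ (γ / 2) / γ ^ (γ / 2) *
        ThreeLines.threeLinesRatio γ (ThreeLines.optimizer γ))
      (𝓝[>] (2 : ℝ)) (𝓝 1) ∧
    -- the integrals in the limit value converge
    (∀ x : ℝ, IntegrableOn (ThreeLines.rePhaseInftyIntegrand x) (Set.Ioi (0 : ℝ)) volume) ∧
    Integrable ThreeLines.limitIntegrand volume ∧
    -- the limit `γ → ∞`
    Tendsto (fun γ : ℝ => 4 * Real.pi *
        ThreeLines.threeLinesRatio γ (ThreeLines.optimizer γ))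
      atTop (𝓝 ThreeLines.limitValue) ∧
    -- its numerical value, correct to six decimals
    |ThreeLines.limitValue - 5.342823| < 5 / 10 ^ 7 := by
  refine ⟨fun γ hγ => ⟨fun z h1 h2 => ?_, ?_, ?_, ?_, ?_, ?_⟩,
    ThreeLines.tendsto_threeLinesRatio_two, ThreeLines.integrableOn_rePhaseInftyIntegrand,
    ThreeLines.integrable_limitIntegrand, ThreeLines.tendsto_threeLinesRatio_atTop,
    ThreeLines.abs_limitValue_sub_lt⟩
  · have hz : |z.im| ≤ 1 := abs_le.2 ⟨h1, h2.trans zero_le_one⟩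
    refine ⟨fun ε hε => ThreeLines.integrableOn_phaseIntegrand hγ hz hε, ?_⟩
    rw [ThreeLines.phase_eq hγ hz]
    exact ThreeLines.tendsto_truncatedPhase hγ hz
  · simpa using ThreeLines.isBoundaryValue_optimizer hγ le_rfl zero_le_one
  · exact ThreeLines.isBoundaryValue_optimizer hγ zero_le_one le_rfl
  · exact ThreeLines.memLp_top_onLine_optimizer hγ (ThreeLines.two_div_mem hγ).1.le
      (ThreeLines.two_div_mem hγ).2.le
  · simpa using ThreeLines.memLp_top_onLine_optimizer hγ le_rfl zero_le_one
  · exact ThreeLines.memLp_two_onLine_optimizer hγ
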